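/- Let $\mathcal L_{TR}=\{\le,\wedge,R\}$, with $\le$ a binary relation symbol, $\wedge$ a binary function symbol and $R$ a ternary relation symbol, and write $x<y$ for $x\le y$ and $x\ne y$. Let TR be the theory with the following axioms, for all $x,y,y',z$: $\le$ is a partial order; if $y,z\le x$ then $y\le z$ or $z\le y$; $x\wedge y\le x$ and $x\wedge y\le y$; if $z\le x$ and $z\le y$ then $z\le x\wedge y$; if $x<y\wedge z$ then $\neg R(x,y,z)$; if $R(x,y,z)$ then $R(x,z,y)$; if $R(x,y,z)$ and $x<y\wedge y'$ then $R(x,y',z)$; if $R(x,y,z)$ then $x<y$ and $x<z$. Let DTR be the theory of the (countable) Fraïssé limit of the class of finitely generated models of TR. For a theory $T$ and a cardinal $\kappa$ we say that $\mathrm{bdn}(T)<\kappa$ if, in a monster model of $T$, for every set $A$, all $A$-mutually indiscernible sequences $(\bar a_\alpha)_{\alpha<\kappa}$, $\bar a_\alpha=(a_{\alpha,i})_{i<\omega}$, of (possibly infinite) tuples, and every single element $b$, there are $\beta<\kappa$ and a sequence $\bar a'$ which is indiscernible over $Ab$ and satisfies $\bar a'\equiv_{a_{\beta,0}A}\bar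 a_\beta$. $T$ is inp-minimal if $\mathrm{bdn}(T)<2$, and NTP$_2$ if $\mathrm{bdn}(T)<\kappa$ for some cardinal $\kappa$. **Proposition.** The theory DTR is well defined and complete, and it is inp-minimal, i.e. $\mathrm{bdn}(\mathrm{DTR})<2$; in particular, it is NTP$_2$. -/

import Mathlib

open FirstOrder FirstOrder.Language CategoryTheory

universe w

/-! ### The language `{≤, ∧, R}` and the theory TR -/

/-- The function symbols of the language of TR: the binary meet. -/
inductive TRFunctions : ℕ → Type
  | meet : TRFunctions 2

/-- The relation symbols of the language of TR: the binary `≤` and the ternary `R`. -/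
inductive TRRelations : ℕ → Type
  | le : TRRelations 2
  | R : TRRelations 3

/-- The language `{≤, ∧, R}`. -/
def LTR : FirstOrder.Language.{0, 0} := ⟨TRFunctions, TRRelations⟩

instance : Countable (Σ l, LTR.Functions l) :=
  Function.Injective.countable (f := fun _ => (0 : ℕ)) (by
    rintro ⟨_, f⟩ ⟨_, g⟩ _
    cases f
    cases g
    rfl)

namespace LTR

/-- The symbol `∧`. -/
def meetSymb : LTR.Functions 2 := TRFunctions.meet

/-- The symbol `≤`. -/
def leSymb : LTR.Relations 2 := TRRelations.le

/-- The symbol `R`. -/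
def RSymb : LTR.Relations 3 := TRRelations.R

variable {n : ℕ}

/-- The term `x ∧ y`. -/
def meet (x y : LTR.Term (Empty ⊕ Fin n)) : LTR.Term (Empty ⊕ Fin n) :=
  meetSymb.apply₂ x y

/-- The formula `x ≤ y`. -/
def le (x y : LTR.Term (Empty ⊕ Fin n)) : LTR.BoundedFormula Empty n :=
  leSymb.boundedFormula₂ x y

/-- The formula `x < y`, that is, `x ≤ y` and `x ≠ y`. -/
def lt (x y : LTR.Term (Empty ⊕ Fin n)) : LTR.BoundedFormula Empty n :=
  le x y ⊓ ∼(x =' y)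

/-- The formula `R(x, y, z)`. -/
def R (x y z : LTR.Term (Empty ⊕ Fin n)) : LTR.BoundedFormula Empty n :=
  RSymb.boundedFormula ![x, y, z]

/-- The theory TR: `≤` is a partial order with linearly ordered initial segments, `∧` is its meet,
and for each `x` the relation `R(x, _, _)` induces a graph on the set of open cones of center `x`.
The variables `&0, &1, &2, &3` stand for `x, y, z, y'`. -/
def TR : LTR.Theory :=
  { -- `x ≤ x`
    ∀' le &0 &0,
    -- `x ≤ y & y ≤ x → x = y`
    ∀' ∀' ((le &0 &1 ⊓ le &1 &0) ⟹ (&0 =' &1)),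
    -- `x ≤ y & y ≤ z → x ≤ z`
    ∀' ∀' ∀' ((le &0 &1 ⊓ le &1 &2) ⟹ le &0 &2),
    -- `y, z ≤ x → y ≤ z or z ≤ y`
    ∀' ∀' ∀' ((le &1 &0 ⊓ le &2 &0) ⟹ (le &1 &2 ⊔ le &2 &1)),
    -- `x ∧ y ≤ x, y`
    ∀' ∀' (le (meet &0 &1) &0 ⊓ le (meet &0 &1) &1),
    -- `z ≤ x, y → z ≤ x ∧ y`
    ∀' ∀' ∀' ((le &2 &0 ⊓ le &2 &1) ⟹ le &2 (meet &0 &1)),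
    -- `x < y ∧ z → ¬ R(x, y, z)`
    ∀' ∀' ∀' (lt &0 (meet &1 &2) ⟹ ∼(R &0 &1 &2)),
    -- `R(x, y, z) → R(x, z, y)`
    ∀' ∀' ∀' (R &0 &1 &2 ⟹ R &0 &2 &1),
    -- `R(x, y, z) & x < y ∧ y' → R(x, y', z)`
    ∀' ∀' ∀' ∀' ((R &0 &1 &2 ⊓ lt &0 (meet &1 &3)) ⟹ R &0 &3 &2),
    -- `R(x, y, z) → x < y, z`
    ∀' ∀' ∀' (R &0 &1 &2 ⟹ (lt &0 &1 ⊓ lt &0 &2)) }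

/-- The class of finitely generated models of TR (including the empty one). -/
def finitelyGeneratedTR : Set (Bundled.{0} LTR.Structure) :=
  {N | Structure.FG LTR N ∧ N ⊨ TR}

/-- DTR, the theory of the Fraïssé limit of the class of finitely generated models of TR. (A limit
is unique up to isomorphism, so the sentences that hold in all limits are the theory of any.) -/
def DTR : LTR.Theory :=
  {φ | ∀ (M : Type) [LTR.Structure M] [Countable M],
    IsFraisseLimit finitelyGeneratedTR M → M ⊨ φ}

end LTR

/-! ### Indiscernible sequences and burden -/

section Burden

variable (L : FirstOrder.Language.{0, 0}) {M : Type w} [L.Structure M]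

/-- `a ≡_A b`: the (possibly infinite) tuples `a` and `b` satisfy the same formulas with parameters
in `A`. -/
def EquivOver (A : Set M) {γ : Type w} (a b : γ → M) : Prop :=
  ∀ φ : L.Formula (A ⊕ γ),
    φ.Realize (Sum.elim (fun x : A => (x : M)) a) ↔ φ.Realize (Sum.elim (fun x : A => (x : M)) b)

/-- The sequence `(a i)_{i < ω}` of `σ`-indexed tuples is indiscernible over `A`: for
`i 0 < ⋯ < i (n - 1)` and `j 0 < ⋯ < j (n - 1)`,
`a (i 0) … a (i (n - 1)) ≡_A a (j 0) … a (j (n - 1))`. -/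
def Indiscernible (A : Set M) {σ : Type w} (a : ℕ → σ → M) : Prop :=
  ∀ (n : ℕ) (i j : Fin n ↪o ℕ),
    EquivOver L A (fun p : Fin n × σ => a (i p.1) p.2) (fun p : Fin n × σ => a (j p.1) p.2)

/-- The sequences `a α` (for `α : ι`) are mutually indiscernible over `A`: each of them is
indiscernible over `A` together with all the other sequences. -/
def MutuallyIndiscernible (A : Set M) {ι : Type w} {σ : ι → Type w} (a : ∀ α, ℕ → σ α → M) : Prop :=
  ∀ α, Indiscernible L (A ∪ {x | ∃ β, β ≠ α ∧ ∃ i k, a β i k = x}) (a α)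

variable {L}

/-- `bdn(T) < κ`: for all `A`-mutually indiscernible sequences `(a α)_{α < κ}` and every element
`b`, there are `β < κ` and a sequence `a'`, indiscernible over `A ∪ {b}`, such that
`a' ≡_{A ∪ a β 0} a β`. In place of a monster model, `A`, `a` and `b` live in an arbitrary
model `M` of `T`, and `a'` lives in some elementary extension `N` of `M`. -/
def BurdenLT (T : L.Theory) (κ : Cardinal.{w}) : Prop :=
  ∀ (M : Theory.ModelType.{0, 0, w} T) (ι : Type w), Cardinal.mk ι = κ →
    ∀ (A : Set M) (σ : ι → Type w) (a : ∀ α, ℕ → σ α → M), MutuallyIndiscernible L A a →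
      ∀ b : M, ∃ (β : ι) (N : Theory.ModelType.{0, 0, w} T) (f : M ↪ₑ[L] N) (a' : ℕ → σ β → N),
        Indiscernible L (f '' (A ∪ {b})) a' ∧
        EquivOver L (f '' (A ∪ Set.range (a β 0)))
          (fun p : ℕ × σ β => a' p.1 p.2) (fun p : ℕ × σ β => f (a β p.1 p.2))

/-- `T` is inp-minimal: `bdn(T) < 2`. -/
def IsInpMinimal (T : L.Theory) : Prop := BurdenLT.{w} T 2

/-- `T` is NTP₂: `bdn(T) < ∞`, that is, `bdn(T) < κ` for some cardinal `κ`. -/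
def IsNTP2 (T : L.Theory) : Prop := ∃ κ : Cardinal.{w}, BurdenLT.{w} T κ

end Burden

/-!
A model of TR is a meet-tree, and the ternary relation is determined by a binary one: `R x y z`
holds only if `x = y ⊓ z`, so everything is encoded by `Adj y z := R (y ⊓ z) y z` (`TRTree`).

*The limit.* Call a tree rich if it has the evident one-point extension properties (`IsRich`). By
back-and-forth (`SameType.exists_adjoin`), tuples with the same quantifier-free type in rich trees
have the same type (`LTR.realize_iff_of_sameType`), and every finitely generated model of TR embeds
in every rich one. A countable rich tree is given explicitly (`PathTree`): a point has a rational
height, and its path from below chooses at every smaller height a cone with a label in `ℕ`, where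
the labels carry a copy of the random graph. It is therefore a Fraïssé limit, DTR is its complete
theory, and every model of DTR is rich, since richness is first-order.

*Inp-minimality.* Let `a` and `b` be mutually indiscernible sequences of tuples, which may be
assumed to contain the parameters and to be closed under meets, and let `c` be an element. It
suffices to find, in an elementary extension, some `c'` that has the type of `c` over the first
tuple of one of the sequences and over which this sequence is indiscernible (`LTR.IsMovable`);
compactness then moves `c'` back to `c`. Consider the traces `{a 0 p ⊓ c}` and `{b 0 k ⊓ c}` on the
branch of `c`.

* If some `a 0 p ⊓ c` lies strictly above the second trace, then `a 0 p` has the type of `c` over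
  `b 0`, and `b` is indiscernible over it: take `c' = a 0 p`. So the traces may be assumed to be
  cofinal in each other.
* If they have no maximum, then `c` is a limit of elements of `a 0`. The chains below `c` that come
  from the different `a i` lie on one branch, because an element of `b 0` bounds them, and `c'` can be
  put above all of them (`LTR.isMovable_of_limit`).
* If they have a maximum `d` that is in both tuples, then by mutual indiscernibility it is in all of
  them, and `c'` can be put into a new cone above `d` (`LTR.isMovable_of_branch`).
* Otherwise `d` is new for at least one of the sequences and fills a cut there. The sequence can be
  moved if the cuts of all its tuples have a common filling (`LTR.isMovable_of_cut`). This is clear if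
  the other tuple contains `d`. If `d` is new for both, failure for both would give two mutually
  indiscernible sequences of intervals, neither of them with a common filling, whose first members
  both contain `d`, which is impossible (`TRTree.forall_lt_or_forall_lt`).
-/

/-! ### Trees with a graph on the cones -/

/-- A meet-tree with, for each `x`, a graph on the open cones of center `x`. As the elements `y`
and `z` lie in different cones of center `x` only for `x = y ⊓ z`, all these graphs are encoded
by one binary relation: `Adj y z` means `R (y ⊓ z) y z`. -/
class TRTree (M : Type*) extends SemilatticeInf M where
  /-- The cones of `y` and of `z` above `y ⊓ z` are adjacent. -/
  Adj : M → M → Prop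
  chain : ∀ {x y z : M}, y ≤ x → z ≤ x → y ≤ z ∨ z ≤ y
  adj_symm : ∀ {y z : M}, Adj y z → Adj z y
  not_le_of_adj : ∀ {y z : M}, Adj y z → ¬ y ≤ z
  adj_cone : ∀ {y z y' : M}, Adj y z → y ⊓ z < y ⊓ y' → Adj y' z

namespace TRTree

section Basic

variable {M : Type*} [TRTree M] {x y z : M}

theorem not_ge_of_adj (h : Adj x y) : ¬ y ≤ x := not_le_of_adj (adj_symm h)

theorem adj_comm : Adj x y ↔ Adj y x := ⟨adj_symm, adj_symm⟩

theorem lt_of_not_le (hy : y ≤ x) (hz : z ≤ x) (h : ¬ y ≤ z) : z < y :=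
  lt_of_le_not_ge ((chain hy hz).resolve_left h) h

/-- The ultrametric inequality for the meet. -/
theorem inf_eq_of_inf_lt (h : x ⊓ y < y ⊓ z) : x ⊓ z = x ⊓ y := by
  apply le_antisymm
  · rcases chain (x := z) (y := x ⊓ z) (z := y ⊓ z) inf_le_right inf_le_right with h1 | h1
    · exact le_inf inf_le_left (h1.trans inf_le_left)
    · exact absurd (le_inf (h1.trans inf_le_left) inf_le_left) h.not_ge
  · exact le_inf inf_le_left (h.le.trans inf_le_right)

theorem adj_iff_of_inf_lt (h : x ⊓ y < y ⊓ z) : Adj y x ↔ Adj z x := by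
  refine ⟨fun h1 => adj_cone h1 (by rwa [inf_comm y x]), fun h1 => adj_cone h1 ?_⟩
  rw [inf_comm z x, inf_comm z y, inf_eq_of_inf_lt h]
  exact h

theorem exists_le_of_chain {α : Type*} [Finite α] [Nonempty α] (g : α → M)
    (h : ∀ i j, g i ≤ g j ∨ g j ≤ g i) : ∃ u, ∀ k, g k ≤ g u := by
  obtain ⟨x, ⟨u, rfl⟩, hu⟩ := (Set.finite_range g).exists_maximal (Set.range_nonempty g)
  exact ⟨u, fun k => (h k u).elim id fun h1 => hu ⟨k, rfl⟩ h1⟩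

theorem exists_ge_of_chain {α : Type*} [Finite α] [Nonempty α] (g : α → M)
    (h : ∀ i j, g i ≤ g j ∨ g j ≤ g i) : ∃ u, ∀ k, g u ≤ g k := by
  obtain ⟨x, ⟨u, rfl⟩, hu⟩ := (Set.finite_range g).exists_minimal (Set.range_nonempty g)
  exact ⟨u, fun k => (h u k).elim id fun h1 => hu ⟨k, rfl⟩ h1⟩

theorem inf_inf_eq_of_not_le (h : ¬ x ⊓ y ≤ z) : x ⊓ y ⊓ z = y ⊓ z := by
  rcases chain (x := y) (y := x ⊓ y) (z := y ⊓ z) inf_le_right inf_le_left with h3 | h3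
  · exact absurd (h3.trans inf_le_right) h
  · exact le_antisymm (le_inf (inf_le_left.trans inf_le_right) inf_le_right)
      (le_inf h3 inf_le_right)

theorem adj_inf_inf_iff {t : M} :
    Adj (x ⊓ y) (z ⊓ t) ↔ ¬ x ⊓ y ≤ z ⊓ t ∧ ¬ z ⊓ t ≤ x ⊓ y ∧ Adj x z := by
  have h0 : ¬ x ⊓ y ≤ z ⊓ t → ¬ z ⊓ t ≤ x ⊓ y → (Adj (x ⊓ y) (z ⊓ t) ↔ Adj x z) := by
    intro h1 h2
    have h3 : z ⊓ t ⊓ (x ⊓ y) < x ⊓ y ⊓ x := by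
      rw [inf_eq_left.2 (inf_le_left : x ⊓ y ≤ x)]
      exact lt_of_le_not_ge inf_le_right fun h => h1 (h.trans inf_le_left)
    have h4 : x ⊓ (z ⊓ t) < z ⊓ t ⊓ z := by
      rw [inf_eq_left.2 (inf_le_left : z ⊓ t ≤ z)]
      refine lt_of_le_not_ge inf_le_right fun h => ?_
      rcases chain (x := x) (y := z ⊓ t) (z := x ⊓ y) (h.trans inf_le_left) inf_le_left with h | h
      exacts [h2 h, h1 h]
    rw [adj_iff_of_inf_lt h3, adj_comm, adj_iff_of_inf_lt h4, adj_comm]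
  exact ⟨fun h => ⟨not_le_of_adj h, not_ge_of_adj h,
    (h0 (not_le_of_adj h) (not_ge_of_adj h)).1 h⟩, fun h => (h0 h.1 h.2.1).2 h.2.2⟩

end Basic

/-! ### Quantifier-free types of tuples -/

/-- The tuples `v` and `v'`, possibly in different trees, have the same quantifier-free type. -/
structure SameType {α M N : Type*} [TRTree M] [TRTree N] (v : α → M) (v' : α → N) : Prop where
  le_iff : ∀ i j k, v i ⊓ v j ≤ v k ↔ v' i ⊓ v' j ≤ v' k
  adj_iff : ∀ i j, Adj (v i) (v j) ↔ Adj (v' i) (v' j)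

/-- The tuple `v` together with the further element `c`. -/
def adjoin {α M : Type*} (v : α → M) (c : M) : Option α → M := fun o => o.elim c v

@[simp] theorem adjoin_none {α M : Type*} (v : α → M) (c : M) : adjoin v c none = c := rfl

@[simp] theorem adjoin_some {α M : Type*} (v : α → M) (c : M) (i : α) :
    adjoin v c (some i) = v i := rfl

theorem adjoin_comp {α β M : Type*} (v : α → M) (c : M) (g : β → α) :
    adjoin v c ∘ Option.map g = adjoin (v ∘ g) c := by
  funext o; cases o <;> rfl

namespace SameType

variable {α β M N K : Type*} [TRTree M] [TRTree N] [TRTree K]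
  {v : α → M} {v' : α → N} {v'' : α → K} {c : M} {c' : N}

theorem refl (v : α → M) : SameType v v := ⟨fun _ _ _ => Iff.rfl, fun _ _ => Iff.rfl⟩

theorem symm (h : SameType v v') : SameType v' v :=
  ⟨fun i j k => (h.le_iff i j k).symm, fun i j => (h.adj_iff i j).symm⟩

theorem trans (h : SameType v v') (h' : SameType v' v'') : SameType v v'' :=
  ⟨fun i j k => (h.le_iff i j k).trans (h'.le_iff i j k),
    fun i j => (h.adj_iff i j).trans (h'.adj_iff i j)⟩

theorem comp (h : SameType v v') (g : β → α) : SameType (v ∘ g) (v' ∘ g) :=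
  ⟨fun _ _ _ => h.le_iff _ _ _, fun _ _ => h.adj_iff _ _⟩

theorem le (h : SameType v v') (i j : α) : v i ≤ v j ↔ v' i ≤ v' j := by
  simpa using h.le_iff i i j

theorem lt (h : SameType v v') (i j : α) : v i < v j ↔ v' i < v' j := by
  rw [lt_iff_le_not_ge, lt_iff_le_not_ge, h.le, h.le]

theorem eq (h : SameType v v') (i j : α) : v i = v j ↔ v' i = v' j := by
  rw [le_antisymm_iff, le_antisymm_iff, h.le, h.le]

theorem le_inf (h : SameType v v') (i j k : α) : v k ≤ v i ⊓ v j ↔ v' k ≤ v' i ⊓ v' j := by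
  rw [le_inf_iff, le_inf_iff, h.le, h.le]

theorem inf_eq (h : SameType v v') (i j k : α) : v i ⊓ v j = v k ↔ v' i ⊓ v' j = v' k := by
  rw [le_antisymm_iff, le_antisymm_iff, h.le_iff, h.le_inf]

theorem lt_inf (h : SameType v v') (i j k : α) : v k < v i ⊓ v j ↔ v' k < v' i ⊓ v' j := by
  rw [lt_iff_le_not_ge, lt_iff_le_not_ge, h.le_iff, h.le_inf]

theorem three (h : SameType v v') (i j k : α) :
    ∃ p q, v i ⊓ v j ⊓ v k = v p ⊓ v q ∧ v' i ⊓ v' j ⊓ v' k = v' p ⊓ v' q := by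
  by_cases h1 : v i ⊓ v j ≤ v k
  · exact ⟨i, j, inf_eq_left.2 h1, inf_eq_left.2 ((h.le_iff _ _ _).1 h1)⟩
  · exact ⟨j, k, inf_inf_eq_of_not_le h1, inf_inf_eq_of_not_le fun h2 => h1 ((h.le_iff _ _ _).2 h2)⟩

/-- In a tree the pairwise meets of a tuple are closed under meets, in a way that depends only on
the quantifier-free type of the tuple. -/
theorem four (h : SameType v v') (i j k l : α) :
    ∃ p q, v i ⊓ v j ⊓ (v k ⊓ v l) = v p ⊓ v q ∧ v' i ⊓ v' j ⊓ (v' k ⊓ v' l) = v' p ⊓ v' q := by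
  obtain ⟨p, q, h1, h2⟩ := h.three i j k
  obtain ⟨r, s, h3, h4⟩ := h.three p q l
  exact ⟨r, s, by rw [← inf_assoc, h1, h3], by rw [← inf_assoc, h2, h4]⟩

theorem four_le_iff (h : SameType v v') (i j k l p : α) :
    v i ⊓ v j ⊓ (v k ⊓ v l) ≤ v p ↔ v' i ⊓ v' j ⊓ (v' k ⊓ v' l) ≤ v' p := by
  obtain ⟨r, s, h1, h2⟩ := h.four i j k l
  rw [h1, h2, h.le_iff]

theorem pairs (h : SameType v v') :
    SameType (fun p : α × α => v p.1 ⊓ v p.2) (fun p : α × α => v' p.1 ⊓ v' p.2) := by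
  have le : ∀ i j k l p q, v i ⊓ v j ⊓ (v k ⊓ v l) ≤ v p ⊓ v q ↔
      v' i ⊓ v' j ⊓ (v' k ⊓ v' l) ≤ v' p ⊓ v' q := fun i j k l p q => by
    rw [le_inf_iff, le_inf_iff, h.four_le_iff, h.four_le_iff]
  refine ⟨fun i j k => le _ _ _ _ _ _, fun i j => ?_⟩
  have h1 : v i.1 ⊓ v i.2 ≤ v j.1 ⊓ v j.2 ↔ v' i.1 ⊓ v' i.2 ≤ v' j.1 ⊓ v' j.2 := by
    simpa using le i.1 i.2 i.1 i.2 j.1 j.2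
  have h2 : v j.1 ⊓ v j.2 ≤ v i.1 ⊓ v i.2 ↔ v' j.1 ⊓ v' j.2 ≤ v' i.1 ⊓ v' i.2 := by
    simpa using le j.1 j.2 j.1 j.2 i.1 i.2
  rw [adj_inf_inf_iff, adj_inf_inf_iff, h1, h2, h.adj_iff]

theorem adjoin_mk (h : SameType v v') (h1 : ∀ i j, v i ⊓ v j ≤ c ↔ v' i ⊓ v' j ≤ c')
    (h2 : ∀ i k, v i ⊓ c ≤ v k ↔ v' i ⊓ c' ≤ v' k) (h3 : ∀ k, c ≤ v k ↔ c' ≤ v' k)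
    (h4 : ∀ k, Adj c (v k) ↔ Adj c' (v' k)) : SameType (adjoin v c) (adjoin v' c') := by
  refine ⟨?_, ?_⟩
  · rintro (_ | i) (_ | j) (_ | k)
    · simp
    · simpa using h3 k
    · simp
    · simpa [inf_comm] using h2 j k
    · simp
    · simpa using h2 i k
    · simpa using h1 i j
    · simpa using h.le_iff i j k
  · rintro (_ | i) (_ | j)
    · exact iff_of_false (fun h => not_le_of_adj h le_rfl) (fun h => not_le_of_adj h le_rfl)
    · simpa using h4 j
    · simpa [adj_comm (y := c), adj_comm (y := c')] using h4 i
    · simpa using h.adj_iff i j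

theorem adjoin_of_isEmpty [IsEmpty α] (v : α → M) (v' : α → N) (c : M) (c' : N) :
    SameType (adjoin v c) (adjoin v' c') :=
  adjoin_mk ⟨fun i => isEmptyElim i, fun i => isEmptyElim i⟩ (fun i => isEmptyElim i)
    (fun i => isEmptyElim i) (fun i => isEmptyElim i) (fun i => isEmptyElim i)

/-- Two elements `c` and `s` that are closer to each other than to the tuple `v` have the same type
over it. -/
theorem adjoin_of_inf_lt {s : M} (h : ∀ k, v k ⊓ c < c ⊓ s) :
    SameType (adjoin v c) (adjoin v s) := by
  have h0 : ∀ k, v k ⊓ s = v k ⊓ c := fun k => inf_eq_of_inf_lt (h k)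
  refine adjoin_mk (refl v) (fun i j => ?_) (fun i k => by rw [h0]) (fun k => ?_)
    (fun k => adj_iff_of_inf_lt (h k))
  · rw [← inf_eq_left, inf_assoc, ← inf_eq_left (b := s), inf_assoc, h0]
  · refine iff_of_false (fun h1 => ?_) (fun h1 => ?_)
    · exact (h k).not_ge ((inf_le_left.trans (_root_.le_inf h1 le_rfl)))
    · refine (h k).not_ge ?_
      rw [← h0]
      exact inf_le_right.trans (_root_.le_inf h1 le_rfl)

/-- The main criterion for two elements to have the same type over a tuple: every entry of the tuple
is above them, or its meet with them is given by another entry of the tuple. -/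
theorem adjoin_of_forall (h : SameType v v')
    (hA : ∀ k, (c ≤ v k ∧ c' ≤ v' k) ∨ ∃ m, v k ⊓ c = v k ⊓ v m ∧ v' k ⊓ c' = v' k ⊓ v' m ∧
      ¬ c ≤ v k ∧ ¬ c' ≤ v' k ∧ (Adj c (v k) ↔ Adj c' (v' k)))
    (hB : ∀ k l, c ≤ v k → c ≤ v l → (v k ⊓ v l ≤ c ↔ v' k ⊓ v' l ≤ c')) :
    SameType (adjoin v c) (adjoin v' c') := by
  have h3 : ∀ k, c ≤ v k ↔ c' ≤ v' k := fun k => by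
    rcases hA k with ⟨h1, h2⟩ | ⟨m, -, -, h1, h2, -⟩
    exacts [iff_of_true h1 h2, iff_of_false h1 h2]
  refine adjoin_mk h (fun i j => ?_) (fun i k => ?_) h3 (fun k => ?_)
  · have key : ∀ i j, ¬ c ≤ v i → (v i ⊓ v j ≤ c ↔ v' i ⊓ v' j ≤ c') := by
      intro i j hi
      rcases hA i with ⟨h1, h2⟩ | ⟨m, h1, h2, -⟩
      · exact absurd h1 hi
      · have e1 : v i ⊓ v j ≤ c ↔ v i ⊓ v j ≤ v m := by
          have : v i ⊓ v j ≤ c ↔ v i ⊓ v j ≤ v i ⊓ c := by simp [le_inf_iff]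
          rw [this, h1]; simp [le_inf_iff]
        have e2 : v' i ⊓ v' j ≤ c' ↔ v' i ⊓ v' j ≤ v' m := by
          have : v' i ⊓ v' j ≤ c' ↔ v' i ⊓ v' j ≤ v' i ⊓ c' := by simp [le_inf_iff]
          rw [this, h2]; simp [le_inf_iff]
        rw [e1, e2, h.le_iff]
    by_cases hi : c ≤ v i
    · by_cases hj : c ≤ v j
      · exact hB i j hi hj
      · rw [inf_comm, inf_comm (v' i)]
        exact key j i hj
    · exact key i j hi
  · rcases hA i with ⟨h1, h2⟩ | ⟨m, h1, h2, -⟩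
    · rw [inf_eq_right.2 h1, inf_eq_right.2 h2, h3]
    · rw [h1, h2, h.le_iff]
  · rcases hA k with ⟨h1, h2⟩ | ⟨m, -, -, -, -, h5⟩
    · exact iff_of_false (fun h => not_le_of_adj h h1) (fun h => not_le_of_adj h h2)
    · exact h5

/-- The alternative in `adjoin_of_forall` for an entry `v k` that is further from the new elements
than the entry `v m`. -/
theorem closer (h : SameType v v') {k m : α} (h1 : v k ⊓ v m < v m ⊓ c)
    (h2 : v' k ⊓ v' m < v' m ⊓ c') :
    v k ⊓ c = v k ⊓ v m ∧ v' k ⊓ c' = v' k ⊓ v' m ∧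
      ¬ c ≤ v k ∧ ¬ c' ≤ v' k ∧ (Adj c (v k) ↔ Adj c' (v' k)) := by
  refine ⟨inf_eq_of_inf_lt h1, inf_eq_of_inf_lt h2, fun h3 => h1.not_ge ?_,
    fun h3 => h2.not_ge ?_, ?_⟩
  · exact _root_.le_inf (inf_le_right.trans h3) inf_le_left
  · exact _root_.le_inf (inf_le_right.trans h3) inf_le_left
  · rw [← adj_iff_of_inf_lt h1, ← adj_iff_of_inf_lt h2, h.adj_iff]

/-- An element `c` in a new cone above the entry `v r` of the tuple. -/
theorem adjoin_of_branch (h : SameType v v') {r : α} (h1 : v r < c) (h1' : v' r < c')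
    (h2 : ∀ k, v k ⊓ c ≤ v r) (h2' : ∀ k, v' k ⊓ c' ≤ v' r)
    (h3 : ∀ k, v r < v k → (Adj c (v k) ↔ Adj c' (v' k))) :
    SameType (adjoin v c) (adjoin v' c') := by
  have n1 : ∀ k, ¬ c ≤ v k := fun k hk =>
    h1.not_ge ((_root_.le_inf hk le_rfl).trans (h2 k))
  have n2 : ∀ k, ¬ c' ≤ v' k := fun k hk =>
    h1'.not_ge ((_root_.le_inf hk le_rfl).trans (h2' k))
  refine adjoin_of_forall h (fun k => Or.inr ⟨r, ?_, ?_, n1 k, n2 k, ?_⟩)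
    (fun k l hk => absurd hk (n1 k))
  · exact le_antisymm (_root_.le_inf inf_le_left (h2 k)) (inf_le_inf_left _ h1.le)
  · exact le_antisymm (_root_.le_inf inf_le_left (h2' k)) (inf_le_inf_left _ h1'.le)
  · by_cases hk : v r ≤ v k
    · rcases hk.lt_or_eq with hk | hk
      · exact h3 k hk
      · have hk' := (h.eq r k).1 hk
        exact iff_of_false (fun h => not_ge_of_adj h (hk ▸ h1.le))
          (fun h => not_ge_of_adj h (hk' ▸ h1'.le))
    · refine (h.closer (k := k) (m := r) ?_ ?_).2.2.2.2
      · rw [inf_eq_left.2 h1.le]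
        exact lt_of_le_not_ge inf_le_right fun h => hk (h.trans inf_le_left)
      · rw [inf_eq_left.2 h1'.le]
        exact lt_of_le_not_ge inf_le_right fun h' => hk ((h.le _ _).2 (h'.trans inf_le_left))

/-- An element `c` that is the limit of a chain of entries of the tuple. -/
theorem adjoin_of_limit (h : SameType v v')
    (h1 : ∀ k, ∃ m, v m ≤ c ∧ v' m ≤ c' ∧ ¬ v m ≤ v k) :
    SameType (adjoin v c) (adjoin v' c') := by
  have key : ∀ k, ∃ m, v k ⊓ v m < v m ⊓ c ∧ v' k ⊓ v' m < v' m ⊓ c' := fun k => by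
    obtain ⟨m, h2, h3, h4⟩ := h1 k
    refine ⟨m, ?_, ?_⟩
    · rw [inf_eq_left.2 h2]
      exact lt_of_le_not_ge inf_le_right fun h => h4 (h.trans inf_le_left)
    · rw [inf_eq_left.2 h3]
      exact lt_of_le_not_ge inf_le_right fun h' => h4 ((h.le _ _).2 (h'.trans inf_le_left))
  refine adjoin_of_forall h (fun k => ?_) (fun k l hk => ?_)
  · obtain ⟨m, h2, h3⟩ := key k
    exact Or.inr ⟨m, h.closer h2 h3⟩
  · obtain ⟨m, h2, h3⟩ := key k
    exact absurd hk (h.closer h2 h3).2.2.1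

/-- An element `d` that fills a cut of a branch of the meet-closed tuple `v`. -/
theorem adjoin_of_cut (h : SameType v v') (hv : ∀ k l, ∃ m, v k ⊓ v l = v m) {u : α} {d : M}
    {d' : N} (hu : d ≤ v u) (hd : ∀ k, v k ≠ d) (hL : ∀ k, v k < d → v' k < d')
    (hU : ∀ k, d < v k → d' < v' k) : SameType (adjoin v d) (adjoin v' d') := by
  have hu' : d' ≤ v' u := (hU u (lt_of_le_of_ne hu (hd u).symm)).le
  refine adjoin_of_forall h (fun k => ?_) (fun k l hk hl => ?_)
  · obtain ⟨m, hm⟩ := hv k u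
    have hm' := (h.inf_eq _ _ _).1 hm
    have h1 : v m ≤ v u := hm ▸ inf_le_right
    rcases chain hu h1 with h2 | h2
    · have h3 := hU m (lt_of_le_of_ne h2 (hd m).symm)
      exact Or.inl ⟨h2.trans (hm ▸ inf_le_left), h3.le.trans (hm' ▸ inf_le_left)⟩
    · have h2 := lt_of_le_of_ne h2 (hd m)
      refine Or.inr ⟨u, h.closer ?_ ?_⟩
      · rw [hm, inf_eq_right.2 hu]; exact h2
      · rw [hm', inf_eq_right.2 hu']; exact hL m h2
  · obtain ⟨m, hm⟩ := hv k l
    have hm' := (h.inf_eq _ _ _).1 hm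
    have h2 := lt_of_le_of_ne (hm ▸ _root_.le_inf hk hl) (hd m).symm
    rw [hm, hm']
    exact iff_of_false h2.not_ge (hU m h2).not_ge

theorem adjoin_self (h : SameType v v') (k : α) :
    SameType (adjoin v (v k)) (adjoin v' (v' k)) := by
  have := h.comp (fun o : Option α => o.elim k id)
  convert this using 1 <;> · funext o; cases o <;> rfl

theorem comp_adjoin {v : α → M} {v' : α → N} (h : SameType (adjoin v c) (adjoin v' c'))
    (g : β → α) : SameType (adjoin (v ∘ g) c) (adjoin (v' ∘ g) c') := by
  rw [← adjoin_comp, ← adjoin_comp]; exact h.comp _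

end SameType

/-! ### Back-and-forth -/

/-- The extension properties of the existentially closed trees. -/
class IsRich (M : Type*) [TRTree M] : Prop where
  nonempty : Nonempty M
  exists_lt : ∀ u : M, ∃ d, d < u
  exists_between : ∀ l u : M, l < u → ∃ d, l < d ∧ d < u
  exists_branch : ∀ (x : M) (F : Set M) (C : M → Prop), F.Finite → (∀ y ∈ F, x < y) →
    (∀ y ∈ F, ∀ z ∈ F, C y → ¬ C z → y ⊓ z = x) →
    ∃ z, x < z ∧ ∀ y ∈ F, z ⊓ y = x ∧ (Adj z y ↔ C y)

namespace SameType

variable {α M N : Type*} [TRTree M] [TRTree N] {v : α → M} {v' : α → N}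

theorem exists_adjoin_of_branch [IsRich N] [Finite α] (h : SameType v v') {m : M} {r : α}
    (h1 : v r < m) (h2 : ∀ k, v k ⊓ m ≤ v r) : ∃ m', SameType (adjoin v m) (adjoin v' m') := by
  obtain ⟨z, hz, hz'⟩ := IsRich.exists_branch (v' r) (v' '' {k | v r < v k})
    (fun y => ∃ k, v r < v k ∧ v' k = y ∧ Adj m (v k)) (Set.toFinite _)
    (by rintro _ ⟨k, hk, rfl⟩; exact (h.lt _ _).1 hk)
    (by
      rintro _ ⟨k, hk, rfl⟩ _ ⟨l, hl, rfl⟩ ⟨k', hk1, hk2, hk3⟩ hl'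
      rw [← h.eq] at hk2
      rw [hk2] at hk3
      rw [← h.inf_eq]
      by_contra hne
      have h3 : v r < v k ⊓ v l := lt_of_le_of_ne (_root_.le_inf hk.le hl.le) (Ne.symm hne)
      have h4 : m ⊓ v k < v k ⊓ v l := lt_of_le_of_lt (by rw [inf_comm]; exact h2 k) h3
      exact hl' ⟨l, hl, rfl, adj_symm ((adj_iff_of_inf_lt h4).1 (adj_symm hk3))⟩)
  refine ⟨z, h.adjoin_of_branch h1 hz h2 (fun k => ?_) (fun k hk => ?_)⟩
  · by_cases hk : v r < v k
    · rw [inf_comm, (hz' _ ⟨k, hk, rfl⟩).1]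
    · by_cases hk' : v' k ⊓ z ≤ v' r
      · exact hk'
      · exact absurd ((h.lt _ _).2 ((lt_of_not_le inf_le_right hz.le hk').trans_le inf_le_left)) hk
  · rw [(hz' _ ⟨k, hk, rfl⟩).2]
    refine ⟨fun h3 => ⟨k, hk, rfl, h3⟩, ?_⟩
    rintro ⟨k', hk1, hk2, hk3⟩
    rw [← h.eq] at hk2
    rwa [hk2] at hk3

theorem exists_adjoin_of_closed [IsRich N] [Finite α] (h : SameType v v')
    (hv : ∀ k l, ∃ m, v k ⊓ v l = v m) (m : M) : ∃ m', SameType (adjoin v m) (adjoin v' m') := by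
  rcases isEmpty_or_nonempty α with hα | hα
  · exact ⟨(IsRich.nonempty (M := N)).some, adjoin_of_isEmpty _ _ _ _⟩
  by_cases hm : ∃ k, v k = m
  · obtain ⟨k, rfl⟩ := hm
    exact ⟨v' k, h.adjoin_self k⟩
  obtain ⟨u, hu⟩ := exists_le_of_chain (fun k => v k ⊓ m)
    (fun i j => chain inf_le_right inf_le_right)
  by_cases hd : ∃ r, v r = v u ⊓ m
  · obtain ⟨r, hr⟩ := hd
    refine h.exists_adjoin_of_branch (r := r) (lt_of_le_of_ne (hr ▸ inf_le_right)
      fun h => hm ⟨r, h⟩) fun k => ?_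
    rw [hr]
    exact hu k
  push Not at hd
  obtain ⟨d, hdef⟩ : ∃ d, d = v u ⊓ m := ⟨_, rfl⟩
  rw [← hdef] at hd
  have hdu : d < v u := lt_of_le_of_ne (hdef ▸ inf_le_left) (hd u).symm
  -- the cut of `d` in the branch of `v u` is an interval of `v`
  have : Nonempty {k // d < v k ∧ v k ≤ v u} := ⟨⟨u, hdu, le_rfl⟩⟩
  obtain ⟨⟨t, ht, htu⟩, ht'⟩ := exists_ge_of_chain
    (fun k : {k // d < v k ∧ v k ≤ v u} => v k) (fun i j => chain i.2.2 j.2.2)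
  have ht'' : ∀ k, d < v k → v t ≤ v k := fun k hk => by
    obtain ⟨p, hp⟩ := hv k u
    have : v t ≤ v p := ht' ⟨p, lt_of_le_of_ne (hp ▸ _root_.le_inf hk.le hdu.le) (hd p).symm,
      hp ▸ inf_le_right⟩
    exact this.trans (hp ▸ inf_le_left)
  obtain ⟨d', hL, hU⟩ : ∃ d', (∀ k, v k < d → v' k < d') ∧ d' < v' t := by
    rcases isEmpty_or_nonempty {k // v k < d} with hE | hE
    · obtain ⟨d', hd'⟩ := IsRich.exists_lt (v' t)
      exact ⟨d', fun k hk => (hE.false ⟨k, hk⟩).elim, hd'⟩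
    · obtain ⟨⟨l, hl⟩, hl'⟩ := exists_le_of_chain
        (fun k : {k // v k < d} => v k) (fun i j => chain i.2.le j.2.le)
      obtain ⟨d', h1, h2⟩ := IsRich.exists_between (v' l) (v' t) ((h.lt _ _).1 (hl.trans ht))
      exact ⟨d', fun k hk => (((h.le _ _).1 (hl' ⟨k, hk⟩))).trans_lt h1, h2⟩
  have hS := h.adjoin_of_cut hv hdu.le hd hL
    (fun k hk => hU.trans_le ((h.le _ _).1 (ht'' k hk)))
  by_cases hmd : m = d
  · exact ⟨d', hmd ▸ hS⟩
  obtain ⟨m', hm'⟩ := hS.exists_adjoin_of_branch (m := m) (r := none)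
    (lt_of_le_of_ne (hdef ▸ inf_le_right) (Ne.symm hmd)) (by
      rintro (_ | k)
      · exact inf_le_left
      · simp only [adjoin_some, adjoin_none, hdef]
        exact hu k)
  exact ⟨m', hm'.comp_adjoin some⟩

/-- The forth step: the type of a finite tuple, extended by any element, is realized in a rich tree
over any tuple of the same type. -/
theorem exists_adjoin [IsRich N] [Finite α] (h : SameType v v') (m : M) :
    ∃ m', SameType (adjoin v m) (adjoin v' m') := by
  obtain ⟨m', hm'⟩ := h.pairs.exists_adjoin_of_closed (fun k l => by
    obtain ⟨p, q, h1, -⟩ := h.four k.1 k.2 l.1 l.2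
    exact ⟨(p, q), h1⟩) m
  refine ⟨m', ?_⟩
  have := hm'.comp_adjoin (fun i : α => (i, i))
  simpa [Function.comp_def] using this

end SameType

end TRTree

/-! ### Models of TR as trees -/

namespace LTR

open TRTree Structure

/-- The `LTR`-structure on `M` is the one given by its tree structure. -/
class IsTRModel (M : Type*) [LTR.Structure M] [TRTree M] : Prop where
  le_iff : ∀ x y : M, RelMap leSymb ![x, y] ↔ x ≤ y
  meet_eq : ∀ x y : M, funMap meetSymb ![x, y] = x ⊓ y
  R_iff : ∀ x y z : M, RelMap RSymb ![x, y, z] ↔ x = y ⊓ z ∧ Adj y z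

theorem relMap_three {M : Type*} [LTR.Structure M] (r : LTR.Relations 3) (f : Fin 3 → M) :
    RelMap r f ↔ RelMap r ![f 0, f 1, f 2] := by
  have : f = ![f 0, f 1, f 2] := by funext i; fin_cases i <;> rfl
  rw [← this]

theorem realize_R {M : Type*} [LTR.Structure M] {n : ℕ} (x y z : LTR.Term (Empty ⊕ Fin n))
    (v : Empty → M) (xs : Fin n → M) : (R x y z).Realize v xs ↔
      RelMap RSymb ![x.realize (Sum.elim v xs), y.realize (Sum.elim v xs),
        z.realize (Sum.elim v xs)] := by
  rw [R, BoundedFormula.realize_rel, relMap_three]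
  rfl

/-- The tree structure of a model of TR. -/
theorem exists_isTRModel (M : Type*) [LTR.Structure M] (h : M ⊨ TR) :
    ∃ _ : TRTree M, IsTRModel M := by
  simp only [TR, Theory.model_iff, Set.mem_insert_iff, Set.mem_singleton_iff, forall_eq_or_imp,
    forall_eq] at h
  simp [Sentence.Realize, Formula.Realize, le, lt, meet, realize_R,
    BoundedFormula.realize_rel₂, Fin.snoc, Term.realize_functions_apply₂] at h
  obtain ⟨le_refl, le_antisymm, le_trans, chain, inf_le, le_inf, not_R, R_symm, R_cone, R_lt⟩ := h
  let t : SemilatticeInf M :=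
    { le := fun x y => RelMap leSymb ![x, y]
      le_refl := le_refl
      le_trans := le_trans
      le_antisymm := le_antisymm
      inf := fun x y => funMap meetSymb ![x, y]
      inf_le_left := fun x y => (inf_le x y).1
      inf_le_right := fun x y => (inf_le x y).2
      le_inf := fun x y z h1 h2 => le_inf _ _ _ h1 h2 }
  have le_def : ∀ x y : M, RelMap leSymb ![x, y] ↔ x ≤ y := fun _ _ => Iff.rfl
  have inf_def : ∀ x y : M, funMap meetSymb ![x, y] = x ⊓ y := fun _ _ => rfl
  simp only [le_def, inf_def] at chain not_R R_cone R_lt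
  have R_eq : ∀ x y z : M, RelMap RSymb ![x, y, z] → x = y ⊓ z := fun x y z h => by
    by_contra hne
    exact not_R _ _ _ (_root_.le_inf (R_lt _ _ _ h).1.1 (R_lt _ _ _ h).2.1) hne h
  let t' : TRTree M :=
    { t with
      Adj := fun y z => RelMap RSymb ![y ⊓ z, y, z]
      chain := fun {x y z} h1 h2 => chain _ _ _ h1 h2
      adj_symm := fun {y z} h => by rw [inf_comm]; exact R_symm _ _ _ h
      not_le_of_adj := fun {y z} h h1 => (R_lt _ _ _ h).1.2 (inf_eq_left.2 h1)
      adj_cone := fun {y z y'} h1 h2 => by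
        have h3 := R_cone _ _ _ y' h1 h2.le h2.ne
        rwa [← R_eq _ _ _ h3] }
  exact ⟨t', ⟨le_def, inf_def, fun x y z => ⟨fun h => ⟨R_eq _ _ _ h, by
    have h' := h
    rwa [R_eq _ _ _ h] at h'⟩, fun h => by rw [h.1]; exact h.2⟩⟩⟩

theorem model_TR (M : Type*) [LTR.Structure M] [TRTree M] [IsTRModel M] : M ⊨ TR := by
  simp only [TR, Theory.model_iff, Set.mem_insert_iff, Set.mem_singleton_iff, forall_eq_or_imp,
    forall_eq]
  simp [Sentence.Realize, Formula.Realize, le, lt, meet, realize_R,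
    BoundedFormula.realize_rel₂, Fin.snoc, Term.realize_functions_apply₂, IsTRModel.le_iff,
    IsTRModel.meet_eq, IsTRModel.R_iff]
  refine ⟨fun _ _ => le_antisymm, fun _ _ _ => le_trans, fun _ _ _ => chain,
    fun _ _ _ h1 h2 h3 h4 => absurd h4 h3, ?_, ?_, ?_⟩
  · rintro _ y z rfl h
    exact ⟨inf_comm _ _, adj_symm h⟩
  · rintro _ y z y' rfl h h1 h2 h3
    have h4 : y ⊓ z < y ⊓ y' := lt_of_le_of_ne (le_inf h1 h2) h3
    refine ⟨?_, adj_cone h h4⟩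
    rw [inf_comm y' z, inf_eq_of_inf_lt (x := z) (y := y) (z := y') (by rwa [inf_comm z y]),
      inf_comm]
  · rintro _ y z rfl h
    exact ⟨⟨inf_le_left, fun h1 => not_le_of_adj h (inf_eq_left.1 h1)⟩,
      inf_le_right, fun h1 => not_ge_of_adj h (inf_eq_right.1 h1)⟩

theorem relMap_le {M : Type*} [LTR.Structure M] [TRTree M] [IsTRModel M] (f : Fin 2 → M) :
    RelMap leSymb f ↔ f 0 ≤ f 1 := by
  have : f = ![f 0, f 1] := by funext i; fin_cases i <;> rfl
  rw [this, IsTRModel.le_iff]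
  rfl

theorem relMap_R {M : Type*} [LTR.Structure M] [TRTree M] [IsTRModel M] (f : Fin 3 → M) :
    RelMap RSymb f ↔ f 0 = f 1 ⊓ f 2 ∧ Adj (f 1) (f 2) := by
  rw [relMap_three, IsTRModel.R_iff]

theorem funMap_meet {M : Type*} [LTR.Structure M] [TRTree M] [IsTRModel M] (f : Fin 2 → M) :
    funMap meetSymb f = f 0 ⊓ f 1 := by
  have : f = ![f 0, f 1] := by funext i; fin_cases i <;> rfl
  rw [this, IsTRModel.meet_eq]
  rfl

/-! ### Quantifier elimination -/

section QE

variable {α M N : Type*} [LTR.Structure M] [TRTree M] [IsTRModel M]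
  [LTR.Structure N] [TRTree N] [IsTRModel N]

/-- Every term takes the value of a meet of two variables, and which ones depends only on the
quantifier-free type. -/
theorem exists_realize_eq_inf {v : α → M} {v' : α → N} (h : SameType v v') (t : LTR.Term α) :
    ∃ p : α × α, t.realize v = v p.1 ⊓ v p.2 ∧ t.realize v' = v' p.1 ⊓ v' p.2 := by
  induction t with
  | var i => exact ⟨(i, i), by simp⟩
  | @func l f ts ih =>
    match l, f with
    | _, TRFunctions.meet =>
      obtain ⟨p, h1, h2⟩ := ih 0
      obtain ⟨q, h3, h4⟩ := ih 1
      obtain ⟨r, s, h5, h6⟩ := h.four p.1 p.2 q.1 q.2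
      refine ⟨(r, s), ?_, ?_⟩
      · exact (funMap_meet fun i => (ts i).realize v).trans (by rw [h1, h3, h5])
      · exact (funMap_meet fun i => (ts i).realize v').trans (by rw [h2, h4, h6])

theorem relMap_iff_of_sameType {v : α → M} {v' : α → N} (h : SameType v v') {l : ℕ}
    (r : LTR.Relations l) (p : Fin l → α) :
    RelMap r (fun i => v (p i)) ↔ RelMap r (fun i => v' (p i)) := by
  match l, r with
  | _, TRRelations.le =>
    change RelMap leSymb _ ↔ RelMap leSymb _
    rw [relMap_le, relMap_le]
    exact h.le _ _
  | _, TRRelations.R =>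
    change RelMap RSymb _ ↔ RelMap RSymb _
    rw [relMap_R, relMap_R, eq_comm, h.inf_eq, h.adj_iff, eq_comm]

theorem realize_iff_of_finite [IsRich M] [IsRich N] [Finite α] {n : ℕ}
    (φ : LTR.BoundedFormula α n) (v : α → M) (xs : Fin n → M) (v' : α → N) (xs' : Fin n → N)
    (h : SameType (Sum.elim v xs) (Sum.elim v' xs')) : φ.Realize v xs ↔ φ.Realize v' xs' := by
  induction φ with
  | falsum => rfl
  | equal t₁ t₂ =>
    obtain ⟨p, h1, h2⟩ := exists_realize_eq_inf h t₁
    obtain ⟨q, h3, h4⟩ := exists_realize_eq_inf h t₂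
    simp only [BoundedFormula.Realize, h1, h2, h3, h4]
    exact h.pairs.eq p q
  | rel r ts =>
    choose p h1 h2 using fun i => exists_realize_eq_inf h (ts i)
    simp only [BoundedFormula.Realize, h1, h2]
    exact relMap_iff_of_sameType h.pairs r p
  | imp _ _ ih1 ih2 =>
    simp only [BoundedFormula.Realize]
    rw [ih1 _ _ h, ih2 _ _ h]
  | @all n φ ih =>
    have key : ∀ {M N : Type _} [TRTree M] [TRTree N] (v : α → M) (xs : Fin n → M) (v' : α → N)
      (xs' : Fin n → N) (m : M) (m' : N), SameType (adjoin (Sum.elim v xs) m)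
        (adjoin (Sum.elim v' xs') m') →
        SameType (Sum.elim v (Fin.snoc xs m : Fin (n + 1) → M))
          (Sum.elim v' (Fin.snoc xs' m' : Fin (n + 1) → N)) := by
      intro M N _ _ v xs v' xs' m m' h
      have := h.comp (Sum.elim (fun a => some (Sum.inl a))
        (fun i => Fin.lastCases (motive := fun _ => Option (α ⊕ Fin n)) none
          (fun i => some (Sum.inr i)) i))
      convert this using 1
      · funext a
        rcases a with a | i
        · rfl
        · refine Fin.lastCases ?_ (fun i => ?_) i <;> simp
      · funext a
        rcases a with a | i
        · rfl
        · refine Fin.lastCases ?_ (fun i => ?_) i <;> simp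
    simp only [BoundedFormula.Realize]
    constructor
    · intro h1 m'
      obtain ⟨m, hm⟩ := h.symm.exists_adjoin m'
      exact (ih _ _ (key _ _ _ _ _ _ hm.symm)).1 (h1 m)
    · intro h1 m
      obtain ⟨m', hm⟩ := h.exists_adjoin m
      exact (ih _ _ (key _ _ _ _ _ _ hm)).2 (h1 m')

/-- Quantifier elimination: in rich models of TR, the quantifier-free type of a (possibly infinite)
tuple determines its type. -/
theorem realize_iff_of_sameType [IsRich M] [IsRich N] {v : α → M} {v' : α → N}
    (h : SameType v v') (φ : LTR.Formula α) : φ.Realize v ↔ φ.Realize v' := by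
  classical
  rw [Formula.Realize, Formula.Realize,
    ← BoundedFormula.realize_restrictFreeVar (f := id)
      (v := v ∘ (fun i : φ.freeVarFinset => (i : α))) v (fun _ => rfl),
    ← BoundedFormula.realize_restrictFreeVar (f := id)
      (v := v' ∘ (fun i : φ.freeVarFinset => (i : α))) v' (fun _ => rfl)]
  refine realize_iff_of_finite _ _ _ _ _ ?_
  have := h.comp (Sum.elim (fun i : φ.freeVarFinset => (i : α)) (fun i : Fin 0 => i.elim0))
  convert this using 1 <;> · funext i; rcases i with i | i; exacts [rfl, i.elim0]

theorem sameType_of_realize_iff {v : α → M} {v' : α → N}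
    (h : ∀ φ : LTR.Formula α, φ.Realize v ↔ φ.Realize v') : SameType v v' := by
  refine ⟨fun i j k => ?_, fun i j => ?_⟩
  · have := h (leSymb.formula₂ (meetSymb.apply₂ (Term.var i) (Term.var j)) (Term.var k))
    simpa [Formula.realize_rel₂, Term.realize_functions_apply₂, IsTRModel.le_iff,
      IsTRModel.meet_eq] using this
  · have := h (RSymb.formula ![meetSymb.apply₂ (Term.var i) (Term.var j), Term.var i, Term.var j])
    simpa [Formula.realize_rel, relMap_R, Term.realize_functions_apply₂,
      IsTRModel.meet_eq] using this

theorem map_inf {F : Type*} [FunLike F M N] [StrongHomClass LTR F M N] (f : F) (x y : M) :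
    f (x ⊓ y) = f x ⊓ f y := by
  rw [← IsTRModel.meet_eq, HomClass.map_fun, funMap_meet]
  rfl

theorem map_le_iff {F : Type*} [FunLike F M N] [StrongHomClass LTR F M N] (f : F) (x y : M) :
    f x ≤ f y ↔ x ≤ y := by
  rw [← IsTRModel.le_iff x y, ← StrongHomClass.map_rel f, relMap_le]
  rfl

theorem sameType_map {F : Type*} [FunLike F M N] [StrongHomClass LTR F M N] (f : F) (v : α → M) :
    SameType v (f ∘ v) := by
  refine ⟨fun i j k => ?_, fun i j => ?_⟩
  · simp only [Function.comp_apply, ← map_inf, map_le_iff]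
  · have := StrongHomClass.map_rel f RSymb ![v i ⊓ v j, v i, v j]
    rw [relMap_R, relMap_R] at this
    simpa [map_inf] using this.symm

end QE

end LTR

/-! ### A countable rich tree -/

/-- A graph on `ℕ` with the extension property of the random graph. -/
def codeGraph (m n : ℕ) : Prop :=
  m ≠ n ∧ (m ∈ (Denumerable.eqv (Finset ℕ)).symm n ∨ n ∈ (Denumerable.eqv (Finset ℕ)).symm m)

theorem codeGraph_symm {m n : ℕ} (h : codeGraph m n) : codeGraph n m := ⟨h.1.symm, h.2.symm⟩

theorem exists_codeGraph (F : Finset ℕ) (C : ℕ → Prop) :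
    ∃ n, n ∉ F ∧ ∀ m ∈ F, codeGraph n m ↔ C m := by
  classical
  -- a code `n` of the set `{m ∈ F | C m} ∪ {k}`, for a `k` that makes `n` new
  let e := (Denumerable.eqv (Finset ℕ)).symm
  let bad : Finset ℕ := F ∪ F.biUnion e
  obtain ⟨k, hk⟩ := Infinite.exists_notMem_finset (F ∪ bad.biUnion e)
  have hkF : k ∉ F := fun h => hk (Finset.mem_union_left _ h)
  let n := e.symm (insert k (F.filter C))
  have hn : e n = insert k (F.filter C) := e.apply_symm_apply _
  have hbad : n ∉ bad := fun h => hk (Finset.mem_union_right _ (Finset.mem_biUnion.2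
    ⟨n, h, hn ▸ Finset.mem_insert_self _ _⟩))
  have hnF : n ∉ F := fun h => hbad (Finset.mem_union_left _ h)
  refine ⟨n, hnF, fun m hm => ?_⟩
  have h1 : n ≠ m := fun h => hnF (h ▸ hm)
  have h2 : n ∉ e m := fun h => hbad (Finset.mem_union_right _ (Finset.mem_biUnion.2 ⟨m, hm, h⟩))
  have h3 : m ≠ k := fun h => hkF (h ▸ hm)
  have : codeGraph n m ↔ n ∈ e m ∨ m ∈ e n := ⟨fun h => h.2, fun h => ⟨h1, h⟩⟩
  rw [this, hn]
  simp [h2, h3, hm]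

/-- The points of a countable rich tree: a point has a rational height and is reached from below by
choosing, at every smaller height, one of countably many cones, all but finitely often the cone of
label `0`. -/
@[ext]
structure PathTree where
  height : ℚ
  path : ℚ →₀ ℕ
  path_eq_zero : ∀ q, height ≤ q → path q = 0

namespace PathTree

open TRTree

/-- Two points are equal up to the height `h`. -/
def AgreeBelow (x y : PathTree) (h : ℚ) : Prop := ∀ q < h, x.path q = y.path q

/-- The part of the path of `x` below the height `h`. -/
noncomputable def cut (x : PathTree) (h : ℚ) : PathTree where
  height := h
  path := x.path.filter (· < h)
  path_eq_zero _ hq := Finsupp.filter_apply_neg _ _ hq.not_gt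

theorem cut_path {x : PathTree} {h q : ℚ} (hq : q < h) : (x.cut h).path q = x.path q :=
  Finsupp.filter_apply_pos _ _ hq

open Classical in
/-- The heights at which the paths of `x` and `y` separate. -/
noncomputable def splitHeights (x y : PathTree) : Finset ℚ :=
  insert x.height (insert y.height
    ((x.path.support ∪ y.path.support).filter fun q => x.path q ≠ y.path q))

theorem splitHeights_nonempty (x y : PathTree) : (splitHeights x y).Nonempty :=
  ⟨_, Finset.mem_insert_self _ _⟩

/-- The height of the meet of `x` and `y`. -/
noncomputable def meetHeight (x y : PathTree) : ℚ :=
  (splitHeights x y).min' (splitHeights_nonempty x y)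

theorem le_meetHeight {x y : PathTree} {h : ℚ} :
    h ≤ meetHeight x y ↔ h ≤ x.height ∧ h ≤ y.height ∧ AgreeBelow x y h := by
  classical
  rw [meetHeight, Finset.le_min'_iff]
  simp only [splitHeights, Finset.mem_insert, forall_eq_or_imp, Finset.mem_filter,
    Finset.mem_union, Finsupp.mem_support_iff]
  refine and_congr_right fun _ => and_congr_right fun _ => ⟨fun h1 q hq => ?_, fun h1 q hq => ?_⟩
  · by_contra hne
    refine (h1 q ⟨?_, hne⟩).not_gt hq
    by_contra h2
    push Not at h2
    exact hne (h2.1.trans h2.2.symm)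
  · by_contra h2
    exact hq.2 (h1 q (not_le.1 h2))

theorem path_meetHeight_ne {x y : PathTree} (hx : meetHeight x y < x.height)
    (hy : meetHeight x y < y.height) : x.path (meetHeight x y) ≠ y.path (meetHeight x y) := by
  classical
  have h := Finset.min'_mem _ (splitHeights_nonempty x y)
  rw [← meetHeight, splitHeights, Finset.mem_insert, Finset.mem_insert, Finset.mem_filter] at h
  rcases h with h | h | h
  exacts [absurd h hx.ne, absurd h hy.ne, h.2]

noncomputable instance : SemilatticeInf PathTree where
  le x y := x.height ≤ y.height ∧ AgreeBelow x y x.height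
  le_refl x := ⟨le_rfl, fun _ _ => rfl⟩
  le_trans x y z h1 h2 := ⟨h1.1.trans h2.1, fun q hq =>
    (h1.2 q hq).trans (h2.2 q (hq.trans_le h1.1))⟩
  le_antisymm x y h1 h2 := by
    have h : x.height = y.height := le_antisymm h1.1 h2.1
    refine PathTree.ext h (Finsupp.ext fun q => ?_)
    by_cases hq : q < x.height
    · exact h1.2 q hq
    · rw [x.path_eq_zero q (not_lt.1 hq), y.path_eq_zero q (h ▸ not_lt.1 hq)]
  inf x y := x.cut (meetHeight x y)
  inf_le_left x y := ⟨(le_meetHeight.1 le_rfl).1, fun _ hq => cut_path hq⟩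
  inf_le_right x y := ⟨(le_meetHeight.1 le_rfl).2.1, fun q hq =>
    (cut_path hq).trans ((le_meetHeight.1 le_rfl).2.2 q hq)⟩
  le_inf x y z h1 h2 := by
    have h : x.height ≤ meetHeight y z :=
      le_meetHeight.2 ⟨h1.1, h2.1, fun q hq => (h1.2 q hq).symm.trans (h2.2 q hq)⟩
    exact ⟨h, fun q hq => (h1.2 q hq).trans (cut_path (hq.trans_le h)).symm⟩

theorem le_def {x y : PathTree} : x ≤ y ↔ x.height ≤ y.height ∧ AgreeBelow x y x.height := Iff.rfl

theorem height_inf (x y : PathTree) : (x ⊓ y).height = meetHeight x y := rfl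

theorem lt_iff {x y : PathTree} : x < y ↔ x.height < y.height ∧ AgreeBelow x y x.height := by
  rw [lt_iff_le_not_ge, le_def, le_def]
  constructor
  · rintro ⟨⟨h1, h2⟩, h3⟩
    refine ⟨lt_of_not_ge fun h => h3 ⟨h, fun q hq => (h2 q (hq.trans_le h)).symm⟩, h2⟩
  · rintro ⟨h1, h2⟩
    exact ⟨⟨h1.le, h2⟩, fun h => h.1.not_gt h1⟩

noncomputable instance : TRTree PathTree where
  Adj y z := meetHeight y z < y.height ∧ meetHeight y z < z.height ∧
    codeGraph (y.path (meetHeight y z)) (z.path (meetHeight y z))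
  chain {x y z} h1 h2 := by
    rcases le_total y.height z.height with h | h
    · exact Or.inl ⟨h, fun q hq => (h1.2 q hq).trans (h2.2 q (hq.trans_le h)).symm⟩
    · exact Or.inr ⟨h, fun q hq => (h2.2 q hq).trans (h1.2 q (hq.trans_le h)).symm⟩
  adj_symm {y z} h := by
    have : meetHeight z y = meetHeight y z := by
      rw [← height_inf, inf_comm, height_inf]
    rw [this]
    exact ⟨h.2.1, h.1, codeGraph_symm h.2.2⟩
  not_le_of_adj {y z} h h1 := h.1.not_ge (le_meetHeight.2 ⟨le_rfl, h1.1, h1.2⟩)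
  adj_cone {y z y'} h h1 := by
    have h2 : meetHeight y z < meetHeight y y' := (lt_iff.1 h1).1
    obtain ⟨h3, h4, h5⟩ := le_meetHeight.1 (le_refl (meetHeight y y'))
    have h6 : meetHeight y' z = meetHeight y z := by
      apply le_antisymm
      · by_contra hlt
        obtain ⟨h7, h8, h9⟩ := le_meetHeight.1 (le_refl (meetHeight y' z))
        refine h.2.2.1 ?_
        rw [h5 _ h2, h9 _ (not_le.1 hlt)]
      · obtain ⟨h7, h8, h9⟩ := le_meetHeight.1 (le_refl (meetHeight y z))
        exact le_meetHeight.2 ⟨h2.le.trans h4, h8, fun q hq =>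
          (h5 q (hq.trans h2)).symm.trans (h9 q hq)⟩
    rw [h6]
    exact ⟨h2.trans_le h4, h.2.1, h5 _ h2 ▸ h.2.2⟩

instance : Countable PathTree := by
  refine Function.Injective.countable (f := fun x : PathTree => (x.height, x.path)) ?_
  intro x y h
  exact PathTree.ext (congrArg Prod.fst h) (congrArg Prod.snd h)

instance : IsRich PathTree where
  nonempty := ⟨⟨0, 0, fun _ _ => rfl⟩⟩
  exists_lt u := ⟨u.cut (u.height - 1), lt_iff.2 ⟨by simp [cut], fun q hq => cut_path hq⟩⟩
  exists_between l u h := by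
    rw [lt_iff] at h
    obtain ⟨d, h1, h2⟩ := exists_between h.1
    exact ⟨u.cut d, lt_iff.2 ⟨h1, fun q hq => (h.2 q hq).trans (cut_path (hq.trans h1)).symm⟩,
      lt_iff.2 ⟨h2, fun q hq => cut_path hq⟩⟩
  exists_branch x F C hF h1 h2 := by
    classical
    let F' : Finset PathTree := hF.toFinset
    obtain ⟨n, hn, hn'⟩ := exists_codeGraph (F'.image fun y => y.path x.height)
      (fun m => ∃ y ∈ F, C y ∧ y.path x.height = m)
    let z : PathTree := ⟨x.height + 1, x.path + Finsupp.single x.height n, fun q hq => by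
      have : x.height ≠ q := by intro h; linarith
      simp [x.path_eq_zero q (by linarith), this]⟩
    have hz : z.path x.height = n := by simp [z, x.path_eq_zero _ le_rfl]
    have hxz : x < z := lt_iff.2 ⟨by simp [z], fun q hq => by simp [z, hq.ne']⟩
    refine ⟨z, hxz, fun y hy => ?_⟩
    have hmem : y.path x.height ∈ F'.image fun y => y.path x.height :=
      Finset.mem_image_of_mem _ (hF.mem_toFinset.2 hy)
    have hinf : z ⊓ y = x := by
      by_contra hne
      have h3 : x < z ⊓ y := lt_of_le_of_ne (le_inf hxz.le (h1 y hy).le) (Ne.symm hne)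
      have h4 := (le_meetHeight.1 (le_refl (meetHeight z y))).2.2 x.height (lt_iff.1 h3).1
      exact hn (by rw [← hz, h4]; exact hmem)
    refine ⟨hinf, ?_⟩
    have hh : meetHeight z y = x.height := by rw [← height_inf, hinf]
    have hA : Adj z y ↔ codeGraph n (y.path x.height) := by
      change (meetHeight z y < z.height ∧ meetHeight z y < y.height ∧
        codeGraph (z.path (meetHeight z y)) (y.path (meetHeight z y))) ↔ _
      rw [hh, hz]
      exact ⟨fun h => h.2.2, fun h => ⟨(lt_iff.1 hxz).1, (lt_iff.1 (h1 y hy)).1, h⟩⟩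
    rw [hA, hn' _ hmem]
    refine ⟨?_, fun h => ⟨y, hy, h, rfl⟩⟩
    rintro ⟨y', hy', hC, he⟩
    by_contra hC'
    -- equal labels at the height of `x` put `y` and `y'` into one cone
    have h3 : meetHeight y' y = x.height := by rw [← height_inf, h2 y' hy' y hy hC hC']
    refine path_meetHeight_ne (x := y') (y := y) ?_ ?_ ?_ <;> rw [h3]
    exacts [(lt_iff.1 (h1 y' hy')).1, (lt_iff.1 (h1 y hy)).1, he]

end PathTree

/-! ### The Fraïssé limit -/

namespace LTR

open TRTree Structure

instance : IsEmpty LTR.Constants := ⟨fun c => by cases c⟩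

instance : IsEmpty (LTR.Relations 0) := ⟨fun r => by cases r⟩

section Extension

variable {α M N : Type*} [LTR.Structure M] [TRTree M] [IsTRModel M]
  [LTR.Structure N] [TRTree N] [IsTRModel N]

theorem exists_eq_inf_of_mem_closure {w : α → M} {x : M}
    (hx : x ∈ Substructure.closure LTR (Set.range w)) : ∃ p : α × α, w p.1 ⊓ w p.2 = x := by
  refine Substructure.closure_induction (p := fun x => ∃ p : α × α, w p.1 ⊓ w p.2 = x) hx ?_ ?_
  · rintro _ ⟨i, rfl⟩
    exact ⟨(i, i), inf_idem _⟩
  · intro n f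
    match n, f with
    | _, TRFunctions.meet =>
      intro xs h
      obtain ⟨p, hp⟩ := h 0
      obtain ⟨q, hq⟩ := h 1
      obtain ⟨r, s, h1, -⟩ := (SameType.refl w).four p.1 p.2 q.1 q.2
      exact ⟨(r, s), ((funMap_meet xs).trans (by rw [← hp, ← hq, h1])).symm⟩

/-- Tuples of the same quantifier-free type generate isomorphic substructures. -/
theorem exists_embedding_of_sameType {w : α → M} {w' : α → N} (h : SameType w w')
    (S : LTR.Substructure M) (hS : S ≤ Substructure.closure LTR (Set.range w)) :
    ∃ g : S ↪[LTR] N, ∀ (p : α × α) (hp : w p.1 ⊓ w p.2 ∈ S),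
      g ⟨w p.1 ⊓ w p.2, hp⟩ = w' p.1 ⊓ w' p.2 := by
  choose p hp using fun x : S => exists_eq_inf_of_mem_closure (hS x.2)
  have hmap : ∀ (x : S) (q : α × α), w q.1 ⊓ w q.2 = x →
      w' (p x).1 ⊓ w' (p x).2 = w' q.1 ⊓ w' q.2 := fun x q hq =>
    (h.pairs.eq (p x) q).1 ((hp x).trans hq.symm)
  refine ⟨{ toFun := fun x => w' (p x).1 ⊓ w' (p x).2, inj' := ?_, map_fun' := ?_,
            map_rel' := ?_ }, fun q hq => hmap _ q rfl⟩
  · intro x y hxy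
    have := (h.pairs.eq (p x) (p y)).2 hxy
    exact Subtype.ext ((hp x).symm.trans (this.trans (hp y)))
  · intro n f xs
    match n, f with
    | _, TRFunctions.meet =>
      refine Eq.trans ?_ (funMap_meet fun i => w' (p (xs i)).1 ⊓ w' (p (xs i)).2).symm
      obtain ⟨r, s, h1, h2⟩ := h.four (p (xs 0)).1 (p (xs 0)).2 (p (xs 1)).1 (p (xs 1)).2
      rw [h2]
      refine hmap _ (r, s) ?_
      rw [← h1, hp, hp]
      exact (funMap_meet fun i => (xs i : M)).symm
  · intro n r xs
    refine (relMap_iff_of_sameType h.pairs r (fun i => p (xs i))).symm.trans ?_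
    simp only [hp]
    rfl

/-- A structure that embeds into a tree is a tree. -/
theorem exists_isTRModel_of_embedding {K : Type*} [LTR.Structure K] (f : K ↪[LTR] M) :
    ∃ _ : TRTree K, IsTRModel K := by
  have hf : ∀ x y : K, f (funMap meetSymb ![x, y]) = f x ⊓ f y := fun x y => by
    rw [Embedding.map_fun, funMap_meet]
    rfl
  let t : SemilatticeInf K :=
    { le := fun x y => f x ≤ f y
      le_refl := fun _ => le_rfl
      le_trans := fun _ _ _ => le_trans
      le_antisymm := fun _ _ h1 h2 => f.injective (le_antisymm h1 h2)
      inf := fun x y => funMap meetSymb ![x, y]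
      inf_le_left := fun x y => (hf x y).trans_le inf_le_left
      inf_le_right := fun x y => (hf x y).trans_le inf_le_right
      le_inf := fun x y z h1 h2 => (le_inf h1 h2).trans_eq (hf y z).symm }
  have hinf : ∀ x y : K, f (x ⊓ y) = f x ⊓ f y := hf
  have hle : ∀ x y : K, x ≤ y ↔ f x ≤ f y := fun _ _ => Iff.rfl
  have hlt : ∀ x y : K, x < y ↔ f x < f y := fun x y => by
    rw [lt_iff_le_not_ge, lt_iff_le_not_ge, hle, hle]
  let t' : TRTree K :=
    { t with
      Adj := fun y z => Adj (f y) (f z)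
      chain := fun {x y z} h1 h2 => TRTree.chain (x := f x) (y := f y) (z := f z) h1 h2
      adj_symm := fun h => adj_symm h
      not_le_of_adj := fun {y z} h => not_le_of_adj (y := f y) (z := f z) h
      adj_cone := fun {y z y'} h1 h2 => adj_cone (y := f y) h1 (by
        rw [← hinf, ← hinf]
        exact (hlt _ _).1 h2) }
  refine ⟨t', fun x y => ?_, fun x y => rfl, fun x y z => ?_⟩
  · rw [← f.map_rel, relMap_le]
    rfl
  · rw [← f.map_rel, relMap_R, ← f.injective.eq_iff]
    exact and_congr_left fun _ => (hinf y z) ▸ Iff.rfl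

theorem isExtensionPair [IsRich N] : LTR.IsExtensionPair M N := by
  rw [isExtensionPair_iff_exists_embedding_closure_singleton_sup]
  rintro S ⟨X, hX⟩ f m
  have hmem : ∀ x : X, (x : M) ∈ S := fun x => hX ▸ Substructure.subset_closure x.2
  obtain ⟨_, _⟩ := exists_isTRModel_of_embedding S.subtype
  have h0 : SameType (fun x : X => (x : M)) (fun x : X => f ⟨x, hmem x⟩) :=
    (sameType_map S.subtype (fun x : X => (⟨x, hmem x⟩ : S))).symm.trans (sameType_map f _)
  obtain ⟨m', h⟩ := h0.exists_adjoin m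
  obtain ⟨g, hg⟩ := exists_embedding_of_sameType h (Substructure.closure LTR {m} ⊔ S) (by
    refine sup_le ?_ ?_
    · rw [Substructure.closure_le, Set.singleton_subset_iff]
      exact Substructure.subset_closure ⟨none, rfl⟩
    · rw [← hX, Substructure.closure_le]
      exact fun x hx => Substructure.subset_closure ⟨some ⟨x, hx⟩, rfl⟩)
  refine ⟨g, ?_⟩
  ext ⟨x, hx⟩
  obtain ⟨p, rfl⟩ := exists_eq_inf_of_mem_closure (w := fun x : X => (x : M)) (x := x) (by
    have : Set.range (fun x : X => (x : M)) = X := by ext; simp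
    rw [this]
    exact hX ▸ hx)
  have h1 : (⟨(p.1 : M) ⊓ p.2, hx⟩ : S) = ⟨p.1, hmem _⟩ ⊓ ⟨p.2, hmem _⟩ :=
    Subtype.ext (map_inf S.subtype ⟨p.1, hmem _⟩ ⟨p.2, hmem _⟩).symm
  rw [h1, map_inf, ← h1]
  exact (hg (some p.1, some p.2) _).symm

end Extension

noncomputable instance : LTR.Structure PathTree where
  funMap {n} f xs := match n, f with
    | _, TRFunctions.meet => xs 0 ⊓ xs 1
  RelMap {n} r xs := match n, r with
    | _, TRRelations.le => xs 0 ≤ xs 1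
    | _, TRRelations.R => xs 0 = xs 1 ⊓ xs 2 ∧ Adj (xs 1) (xs 2)

instance : IsTRModel PathTree := ⟨fun _ _ => Iff.rfl, fun _ _ => rfl, fun _ _ _ => Iff.rfl⟩

theorem isFraisseLimit_pathTree : IsFraisseLimit finitelyGeneratedTR PathTree where
  ultrahomogeneous := (isUltrahomogeneous_iff_IsExtensionPair Structure.cg_of_countable).2
    isExtensionPair
  age := by
    ext N
    constructor
    · rintro ⟨hN, ⟨f⟩⟩
      obtain ⟨_, _⟩ := exists_isTRModel_of_embedding f
      exact ⟨hN, model_TR N⟩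
    · rintro ⟨hN, hT⟩
      obtain ⟨t, ht⟩ := exists_isTRModel N hT
      obtain ⟨f, -⟩ := embedding_from_cg hN.cg default (isExtensionPair (M := N) (N := PathTree))
      exact ⟨hN, ⟨f⟩⟩

theorem DTR_eq_completeTheory : DTR = LTR.completeTheory PathTree := by
  ext φ
  constructor
  · intro h
    exact h PathTree isFraisseLimit_pathTree
  · intro h M _ _ hM
    obtain ⟨e⟩ := isFraisseLimit_pathTree.nonempty_equiv hM
    exact (StrongHomClass.realize_sentence e φ).1 h

theorem DTR_isComplete : DTR.IsComplete := by
  rw [DTR_eq_completeTheory]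
  have : Nonempty PathTree := IsRich.nonempty
  exact completeTheory.isComplete _ _

theorem realize_of_model_DTR {M : Type*} [LTR.Structure M] (hM : M ⊨ DTR) {φ : LTR.Sentence}
    (h : PathTree ⊨ φ) : M ⊨ φ := by
  refine Theory.realize_sentence_of_mem DTR ?_
  rw [DTR_eq_completeTheory]
  exact h

theorem model_TR_of_model_DTR {M : Type*} [LTR.Structure M] (hM : M ⊨ DTR) : M ⊨ TR :=
  (Theory.model_iff _).2 fun φ hφ => realize_of_model_DTR hM
    ((Theory.model_iff _).1 (model_TR PathTree) φ hφ)

/-! ### Models of DTR are rich -/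

section Rich

open Classical in
/-- The formula `φ` or its negation, according to the truth value `p`. -/
noncomputable def literal {α : Type*} (φ : LTR.Formula α) (p : Prop) : LTR.Formula α :=
  if p then φ else ∼φ

theorem realize_literal {α M : Type*} [LTR.Structure M] (φ : LTR.Formula α) (p : Prop)
    (v : α → M) : (literal φ p).Realize v ↔ (p ↔ φ.Realize v) := by
  by_cases h : p <;> simp [literal, h]

/-- The formula that expresses the quantifier-free type of the finite tuple `u`. -/
noncomputable def typeFormula {α M : Type*} [Finite α] [TRTree M] (u : α → M) : LTR.Formula α :=
  Formula.iInf (fun t : α × α × α =>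
    literal (leSymb.formula₂ (meetSymb.apply₂ (Term.var t.1) (Term.var t.2.1)) (Term.var t.2.2))
      (u t.1 ⊓ u t.2.1 ≤ u t.2.2)) ⊓
  Formula.iInf (fun t : α × α =>
    literal (RSymb.formula ![meetSymb.apply₂ (Term.var t.1) (Term.var t.2), Term.var t.1,
      Term.var t.2]) (Adj (u t.1) (u t.2)))

theorem realize_typeFormula {α M N : Type*} [Finite α] [TRTree M] [LTR.Structure N] [TRTree N]
    [IsTRModel N] (u : α → M) (v : α → N) : (typeFormula u).Realize v ↔ SameType u v := by
  have h1 : ∀ i j k, (leSymb.formula₂ (meetSymb.apply₂ (Term.var i) (Term.var j))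
      (Term.var k) : LTR.Formula α).Realize v ↔ v i ⊓ v j ≤ v k := fun i j k => by
    simp [Formula.realize_rel₂, Term.realize_functions_apply₂, IsTRModel.le_iff,
      IsTRModel.meet_eq]
  have h2 : ∀ i j, (RSymb.formula ![meetSymb.apply₂ (Term.var i) (Term.var j), Term.var i,
      Term.var j] : LTR.Formula α).Realize v ↔ Adj (v i) (v j) := fun i j => by
    simp [Formula.realize_rel, relMap_R, Term.realize_functions_apply₂, IsTRModel.meet_eq]
  rw [typeFormula, Formula.realize_inf, Formula.realize_iInf, Formula.realize_iInf]
  simp only [realize_literal, h1, h2]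
  exact ⟨fun h => ⟨fun i j k => h.1 (i, j, k), fun i j => h.2 (i, j)⟩,
    fun h => ⟨fun _ => h.le_iff _ _ _, fun _ => h.adj_iff _ _⟩⟩

variable {M : Type*} [LTR.Structure M] [TRTree M] [IsTRModel M]

/-- The formula which says that some element extends a tuple in the way `z` extends `u`. -/
noncomputable def extensionFormula {α : Type*} [Finite α] (u : α → PathTree) (z : PathTree) :
    LTR.Formula α :=
  Formula.iExs Unit ((typeFormula (adjoin u z)).relabel
    (fun o : Option α => o.elim (Sum.inr ()) Sum.inl))

theorem realize_extensionFormula {α : Type*} [Finite α] (u : α → PathTree) (z : PathTree)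
    (v : α → M) : (extensionFormula u z).Realize v ↔ ∃ m, SameType (adjoin u z) (adjoin v m) := by
  have : ∀ i : Unit → M, Sum.elim v i ∘ (fun o : Option α => o.elim (Sum.inr ()) Sum.inl) =
      adjoin v (i ()) := fun i => by funext o; cases o <;> rfl
  simp only [extensionFormula, Formula.realize_iExs, Formula.realize_relabel, realize_typeFormula,
    this]
  exact ⟨fun ⟨i, hi⟩ => ⟨i (), hi⟩, fun ⟨m, hm⟩ => ⟨fun _ => m, hm⟩⟩

/-- The forth property from the Fraïssé limit to the models of DTR. -/
theorem exists_adjoin_of_model_DTR (hM : M ⊨ DTR) {α : Type} [Finite α] {u : α → PathTree}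
    {v : α → M} (h : SameType u v) (z : PathTree) : ∃ m, SameType (adjoin u z) (adjoin v m) := by
  let φ : LTR.Sentence := Formula.iAlls α (((typeFormula u).imp (extensionFormula u z)).relabel
    (Sum.inr : α → Empty ⊕ α))
  have h1 : M ⊨ φ := by
    refine realize_of_model_DTR hM ?_
    simp only [φ, Sentence.Realize, Formula.realize_iAlls, Formula.realize_relabel,
      Formula.realize_imp, realize_typeFormula, realize_extensionFormula]
    exact fun _ hw => hw.exists_adjoin z
  simp only [φ, Sentence.Realize, Formula.realize_iAlls, Formula.realize_relabel,
    Formula.realize_imp, realize_typeFormula, realize_extensionFormula] at h1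
  exact h1 v h

theorem exists_sameType_pathTree {α : Type*} [Finite α] (v : α → M) :
    ∃ u : α → PathTree, SameType v u := by
  let S := Substructure.closure LTR (Set.range v)
  let v' : α → S := fun i => ⟨v i, Substructure.subset_closure ⟨i, rfl⟩⟩
  obtain ⟨_, _⟩ := exists_isTRModel_of_embedding S.subtype
  have hS : Structure.FG LTR S :=
    (Substructure.fg_iff_structure_fg _).1 (Substructure.fg_closure (Set.finite_range v))
  obtain ⟨f, -⟩ := embedding_from_cg hS.cg default (isExtensionPair (M := S) (N := PathTree))
  exact ⟨f ∘ v', (sameType_map S.subtype v').symm.trans (sameType_map f v')⟩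

theorem isRich_of_model_DTR (hM : M ⊨ DTR) : IsRich M where
  nonempty := by
    obtain ⟨m, -⟩ := exists_adjoin_of_model_DTR hM (α := Empty) (u := Empty.elim)
      (v := Empty.elim) ⟨fun i => i.elim, fun i => i.elim⟩ (IsRich.nonempty (M := PathTree)).some
    exact ⟨m⟩
  exists_lt x := by
    obtain ⟨u, hu⟩ := exists_sameType_pathTree (fun _ : Unit => x)
    obtain ⟨z, hz⟩ := IsRich.exists_lt (u ())
    obtain ⟨m, hm⟩ := exists_adjoin_of_model_DTR hM hu.symm z
    exact ⟨m, (hm.lt none (some ())).1 hz⟩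
  exists_between x y hxy := by
    obtain ⟨u, hu⟩ := exists_sameType_pathTree (fun b : Bool => cond b x y)
    obtain ⟨z, hz, hz'⟩ := IsRich.exists_between (u true) (u false) ((hu.lt true false).1 hxy)
    obtain ⟨m, hm⟩ := exists_adjoin_of_model_DTR hM hu.symm z
    exact ⟨m, (hm.lt (some true) none).1 hz, (hm.lt none (some false)).1 hz'⟩
  exists_branch x F C hF h1 h2 := by
    obtain ⟨n, y, rfl⟩ : ∃ (n : ℕ) (y : Fin n → M), F = Set.range y := by
      have := hF.to_subtype
      obtain ⟨n, ⟨e⟩⟩ := Finite.exists_equiv_fin F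
      exact ⟨n, fun i => e.symm i, by
        rw [← Function.comp_def, e.symm.surjective.range_comp, Subtype.range_coe]⟩
    obtain ⟨u, hu⟩ := exists_sameType_pathTree (adjoin y x)
    obtain ⟨z, hz, hz'⟩ := IsRich.exists_branch (u none) (Set.range fun i => u (some i))
      (fun t => ∃ i, u (some i) = t ∧ C (y i)) (Set.finite_range _)
      (by
        rintro _ ⟨i, rfl⟩
        exact (hu.lt none (some i)).1 (h1 _ ⟨i, rfl⟩))
      (by
        rintro _ ⟨i, rfl⟩ _ ⟨j, rfl⟩ ⟨k, hk, hCk⟩ hj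
        rw [← hk]
        exact (hu.inf_eq (some k) (some j) none).1 (h2 _ ⟨k, rfl⟩ _ ⟨j, rfl⟩ hCk
          fun hCj => hj ⟨j, rfl, hCj⟩))
    obtain ⟨m, hm⟩ := exists_adjoin_of_model_DTR hM hu.symm z
    refine ⟨m, (hm.lt (some none) none).1 hz, ?_⟩
    rintro _ ⟨i, rfl⟩
    refine ⟨(hm.inf_eq none (some (some i)) (some none)).1 (hz' _ ⟨i, rfl⟩).1,
      (hm.adj_iff none (some (some i))).symm.trans ((hz' _ ⟨i, rfl⟩).2.trans ⟨?_, fun h =>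
        ⟨i, rfl, h⟩⟩)⟩
    rintro ⟨j, hj, hC⟩
    rw [← hu.eq] at hj
    have hj' : y j = y i := hj
    exact hj' ▸ hC

end Rich

end LTR

/-! ### Compactness -/

section Compactness

variable {L : FirstOrder.Language.{0, 0}}

/-- A finitely satisfiable family of formulas over a model is realized in an elementary
extension. -/
theorem exists_realize_of_finite {T : L.Theory} (M : Theory.ModelType.{0, 0, w} T) {γ : Type w}
    {ι : Type*} (p : ι → L.Formula (M ⊕ γ))
    (h : ∀ s : Finset ι, ∃ g : γ → M, ∀ i ∈ s, (p i).Realize (Sum.elim id g)) :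
    ∃ (N : Theory.ModelType.{0, 0, w} T) (f : M ↪ₑ[L] N) (g : γ → N),
      ∀ i, (p i).Realize (Sum.elim f g) := by
  classical
  let D : Set (L.Formula (M ⊕ γ)) := {φ | ∃ ψ : L.Formula M, ψ.Realize id ∧ φ = ψ.relabel Sum.inl}
  let T' : L[[M ⊕ γ]].Theory := Formula.equivSentence '' (Set.range p ∪ D)
  have hT' : T'.IsSatisfiable := by
    rw [Theory.isSatisfiable_iff_isFinitelySatisfiable]
    intro T0 hT0
    obtain ⟨q, hq, rfl⟩ := Finset.subset_set_image_iff.1 hT0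
    obtain ⟨s, -, hs⟩ := Finset.subset_set_image_iff (t := q.filter (· ∈ Set.range p))
      (s := Set.univ) (f := p) |>.1 (by
        intro φ hφ
        rw [Set.image_univ]
        exact (Finset.mem_filter.1 hφ).2)
    obtain ⟨g, hg⟩ := h s
    let := constantsOn.structure (Sum.elim id g : M ⊕ γ → M)
    have : M ⊨ ((q.image Formula.equivSentence : Finset _) : L[[M ⊕ γ]].Theory) := by
      rw [Theory.model_iff]
      intro φ hφ
      obtain ⟨φ', hφ', rfl⟩ := Finset.mem_image.1 (Finset.mem_coe.1 hφ)
      rw [Formula.realize_equivSentence]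
      change φ'.Realize (Sum.elim id g)
      rcases hq hφ' with h1 | ⟨ψ, hψ, rfl⟩
      · have h2 := Finset.mem_filter.2 ⟨hφ', h1⟩
        rw [← hs] at h2
        obtain ⟨i, hi, rfl⟩ := Finset.mem_image.1 h2
        exact hg i hi
      · rw [Formula.realize_relabel]
        exact hψ
    exact Theory.Model.isSatisfiable M
  obtain ⟨N⟩ := hT'
  let _ : L.Structure N := (L.lhomWithConstants (M ⊕ γ)).reduct N
  have : (L.lhomWithConstants (M ⊕ γ)).IsExpansionOn N := LHom.isExpansionOn_reduct _ _
  let k : M ⊕ γ → N := fun a => (L.con a : N)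
  have hk : ∀ φ ∈ Set.range p ∪ D, φ.Realize k := fun φ hφ =>
    (Formula.realize_equivSentence N φ).1
      (Theory.realize_sentence_of_mem T' (Set.mem_image_of_mem _ hφ))
  have hD : ∀ ψ : L.Formula M, ψ.Realize id → ψ.Realize (k ∘ Sum.inl) := fun ψ hψ => by
    rw [← Formula.realize_relabel]
    exact hk _ (Or.inr ⟨ψ, hψ, rfl⟩)
  have hD' : ∀ ψ : L.Formula M, ψ.Realize (k ∘ Sum.inl) ↔ ψ.Realize id := fun ψ => by
    refine ⟨fun h1 => ?_, hD ψ⟩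
    by_contra h2
    exact hD (∼ψ) (Formula.realize_not.2 h2) h1
  let f : M ↪ₑ[L] N := ⟨k ∘ Sum.inl, fun n φ x => by
    have := hD' (φ.relabel x)
    rwa [Formula.realize_relabel, Formula.realize_relabel] at this⟩
  have hN : N ⊨ T := (f.theory_model_iff T).1 M.is_model
  refine ⟨⟨N⟩, f, k ∘ Sum.inr, fun i => ?_⟩
  have := hk (p i) (Or.inl ⟨i, rfl⟩)
  rwa [← Sum.elim_comp_inl_inr k] at this

/-- Tuples of the same type over which one and the same formula is satisfiable. -/
theorem exists_realize_of_forall_realize {M γ δ : Type*} [L.Structure M] [Nonempty M]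
    {y y' : δ → M} (h : ∀ φ : L.Formula δ, φ.Realize y' → φ.Realize y) (φ : L.Formula (γ ⊕ δ))
    (x : γ → M) (hx : φ.Realize (Sum.elim x y')) : ∃ g : γ → M, φ.Realize (Sum.elim g y) := by
  classical
  let e : φ.freeVarFinset → δ ⊕ φ.freeVarFinset := fun k =>
    Sum.elim (fun _ => Sum.inr k) (fun d => Sum.inl d) (k : γ ⊕ δ)
  let ψ : L.Formula (δ ⊕ φ.freeVarFinset) := φ.restrictFreeVar e
  have h1 : (ψ.iExs φ.freeVarFinset).Realize y' := by
    rw [Formula.realize_iExs]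
    refine ⟨fun k => Sum.elim x y' k, ?_⟩
    refine (BoundedFormula.realize_restrictFreeVar (Sum.elim x y') ?_).2 hx
    rintro ⟨k | k, hk⟩ <;> rfl
  have h2 := h _ h1
  rw [Formula.realize_iExs] at h2
  obtain ⟨i, hi⟩ := h2
  refine ⟨fun c => if hc : Sum.inl c ∈ φ.freeVarFinset then i ⟨_, hc⟩ else Classical.arbitrary M,
    (BoundedFormula.realize_restrictFreeVar _ ?_).1 hi⟩
  rintro ⟨k | k, hk⟩
  · simp [e, hk]
  · rfl

end Compactness

namespace LTR

open TRTree Structure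

theorem exists_tree_of_modelType (M : Theory.ModelType.{0, 0, w} DTR) :
    ∃ _ : TRTree M, IsTRModel M ∧ IsRich M := by
  obtain ⟨t, h⟩ := exists_isTRModel M (model_TR_of_model_DTR M.is_model)
  exact ⟨t, h, isRich_of_model_DTR M.is_model⟩

/-- The tree of a model of DTR. -/
noncomputable instance treeOfModelType (M : Theory.ModelType.{0, 0, w} DTR) : TRTree M :=
  (exists_tree_of_modelType M).choose

instance (M : Theory.ModelType.{0, 0, w} DTR) : IsTRModel M :=
  (exists_tree_of_modelType M).choose_spec.1

instance (M : Theory.ModelType.{0, 0, w} DTR) : IsRich M :=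
  (exists_tree_of_modelType M).choose_spec.2

variable {M : Theory.ModelType.{0, 0, w} DTR}

/-- An elementary extension realizes every tuple over a tuple of the same type. -/
theorem exists_sameType_extension {γ δ : Type w} (x : γ → M) (y y' : δ → M)
    (h : SameType y y') : ∃ (N : Theory.ModelType.{0, 0, w} DTR) (f : M ↪ₑ[LTR] N) (x' : γ → N),
      SameType (Sum.elim x' (f ∘ y)) (Sum.elim x y') := by
  obtain ⟨N, f, x', hx'⟩ := exists_realize_of_finite M (γ := γ)
    (fun ψ : {ψ : LTR.Formula (γ ⊕ δ) // ψ.Realize (Sum.elim x y')} =>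
      ψ.1.relabel (Sum.elim Sum.inr (fun d => Sum.inl (y d)))) (by
    intro s
    obtain ⟨g, hg⟩ := exists_realize_of_forall_realize
      (fun φ => (realize_iff_of_sameType h φ).2)
      (Formula.iInf fun ψ : s => ψ.1.1) x (by
        rw [Formula.realize_iInf]
        exact fun ψ => ψ.1.2)
    rw [Formula.realize_iInf] at hg
    refine ⟨g, fun ψ hψ => ?_⟩
    rw [Formula.realize_relabel]
    convert hg ⟨ψ, hψ⟩ using 1
    funext i
    rcases i with i | i <;> rfl)
  refine ⟨N, f, x', (sameType_of_realize_iff fun φ => ?_)⟩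
  have key : ∀ φ : LTR.Formula (γ ⊕ δ), φ.Realize (Sum.elim x y') →
      φ.Realize (Sum.elim x' (f ∘ y)) := fun φ hφ => by
    have := hx' ⟨φ, hφ⟩
    rw [Formula.realize_relabel] at this
    convert this using 1
    funext i
    rcases i with i | i <;> rfl
  refine ⟨fun h1 => ?_, key φ⟩
  by_contra h2
  exact key (∼φ) (Formula.realize_not.2 h2) h1

theorem exists_cut_of_finite {M α β : Type*} [TRTree M] [IsRich M] [Finite α] [Finite β]
    (l : α → M) (u : β → M) (hl : ∀ i j, l i ≤ l j ∨ l j ≤ l i)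
    (hlu : ∀ i j k, l i < u j ⊓ u k) : ∃ d, (∀ i, l i < d) ∧ ∀ j, d < u j := by
  rcases isEmpty_or_nonempty α with hα | hα <;> rcases isEmpty_or_nonempty β with hβ | hβ
  · exact ⟨(IsRich.nonempty (M := M)).some, isEmptyElim, isEmptyElim⟩
  · let j₀ : β := Classical.arbitrary β
    obtain ⟨j, hj⟩ := exists_ge_of_chain (fun j => u j ⊓ u j₀)
      fun _ _ => chain inf_le_right inf_le_right
    obtain ⟨d, hd⟩ := IsRich.exists_lt (u j ⊓ u j₀)
    exact ⟨d, isEmptyElim, fun k => hd.trans_le ((hj k).trans inf_le_left)⟩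
  · obtain ⟨i, hi⟩ := exists_le_of_chain l hl
    obtain ⟨d, hd, -⟩ := IsRich.exists_branch (l i) ∅ (fun _ => True) Set.finite_empty
      (by simp) (by simp)
    exact ⟨d, fun k => (hi k).trans_lt hd, isEmptyElim⟩
  · let j₀ : β := Classical.arbitrary β
    obtain ⟨j, hj⟩ := exists_ge_of_chain (fun j => u j ⊓ u j₀)
      fun _ _ => chain inf_le_right inf_le_right
    obtain ⟨i, hi⟩ := exists_le_of_chain l hl
    obtain ⟨d, h1, h2⟩ := IsRich.exists_between _ _ (hlu i j j₀)
    exact ⟨d, fun k => (hi k).trans_lt h1, fun k => h2.trans_le ((hj k).trans inf_le_left)⟩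

/-- The formula `s < t`. -/
def ltFormula {α : Type*} (s t : LTR.Term α) : LTR.Formula α :=
  leSymb.formula₂ s t ⊓ ∼(s.equal t)

theorem realize_ltFormula {α M : Type*} [LTR.Structure M] [TRTree M] [IsTRModel M]
    (s t : LTR.Term α) (v : α → M) : (ltFormula s t).Realize v ↔ s.realize v < t.realize v := by
  simp [ltFormula, Formula.realize_rel₂, IsTRModel.le_iff, lt_iff_le_and_ne]

/-- A cut of a model is filled in an elementary extension. -/
theorem exists_cut_extension {α β : Type*} (l : α → M) (u : β → M)
    (hl : ∀ i j, l i ≤ l j ∨ l j ≤ l i) (hlu : ∀ i j k, l i < u j ⊓ u k) :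
    ∃ (N : Theory.ModelType.{0, 0, w} DTR) (f : M ↪ₑ[LTR] N) (d : N),
      (∀ i, f (l i) < d) ∧ ∀ j, d < f (u j) := by
  obtain ⟨N, f, g, hg⟩ := exists_realize_of_finite M (γ := PUnit)
    (Sum.elim (fun i : α => ltFormula (Term.var (Sum.inl (l i))) (Term.var (Sum.inr PUnit.unit)))
      (fun j : β => ltFormula (Term.var (Sum.inr PUnit.unit)) (Term.var (Sum.inl (u j))))) (by
    intro s
    have : Finite {i // Sum.inl i ∈ s} :=
      (s.finite_toSet.preimage Sum.inl_injective.injOn).to_subtype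
    have : Finite {j // Sum.inr j ∈ s} :=
      (s.finite_toSet.preimage Sum.inr_injective.injOn).to_subtype
    obtain ⟨d, h1, h2⟩ := exists_cut_of_finite (fun i : {i // Sum.inl i ∈ s} => l i)
      (fun j : {j // Sum.inr j ∈ s} => u j) (fun i j => hl i j) (fun i j k => hlu i j k)
    refine ⟨fun _ => d, ?_⟩
    rintro (i | j) hs
    · simpa [realize_ltFormula] using h1 ⟨i, hs⟩
    · simpa [realize_ltFormula] using h2 ⟨j, hs⟩)
  exact ⟨N, f, g PUnit.unit, fun i => by simpa [realize_ltFormula] using hg (Sum.inl i),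
    fun j => by simpa [realize_ltFormula] using hg (Sum.inr j)⟩

/-- In an elementary extension there is a new cone above `x` with prescribed adjacencies. -/
theorem exists_branch_extension {α : Type*} (x : M) (y : α → M) (C : α → Prop)
    (h1 : ∀ i, x < y i) (h2 : ∀ i j, C i → ¬ C j → y i ⊓ y j = x) :
    ∃ (N : Theory.ModelType.{0, 0, w} DTR) (f : M ↪ₑ[LTR] N) (z : N), f x < z ∧
      ∀ i, z ⊓ f (y i) = f x ∧ (Adj z (f (y i)) ↔ C i) := by
  let z : LTR.Term (M ⊕ PUnit.{w + 1}) := Term.var (Sum.inr PUnit.unit)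
  have hreal : ∀ {K : Theory.ModelType.{0, 0, w} DTR} (f : M → K) (g : PUnit.{w + 1} → K) (i : α),
      ((meetSymb.apply₂ z (Term.var (Sum.inl (y i)))).equal (Term.var (Sum.inl x)) ⊓
        literal (RSymb.formula ![meetSymb.apply₂ z (Term.var (Sum.inl (y i))), z,
          Term.var (Sum.inl (y i))]) (C i) : LTR.Formula (M ⊕ PUnit.{w + 1})).Realize
        (Sum.elim f g) ↔
      g PUnit.unit ⊓ f (y i) = f x ∧ (Adj (g PUnit.unit) (f (y i)) ↔ C i) := fun f g i => by
    rw [iff_comm (b := C i)]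
    simp [z, realize_literal, Formula.realize_rel, relMap_R, Term.realize_functions_apply₂,
      IsTRModel.meet_eq]
  obtain ⟨N, f, g, hg⟩ := exists_realize_of_finite M (γ := PUnit)
    (fun o : Option α => o.elim (ltFormula (Term.var (Sum.inl x)) z) fun i =>
      (meetSymb.apply₂ z (Term.var (Sum.inl (y i)))).equal (Term.var (Sum.inl x)) ⊓
        literal (RSymb.formula ![meetSymb.apply₂ z (Term.var (Sum.inl (y i))), z,
          Term.var (Sum.inl (y i))]) (C i)) (by
    intro s
    have : Finite {i // some i ∈ s} :=
      (s.finite_toSet.preimage (Option.some_injective α).injOn).to_subtype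
    obtain ⟨d, h3, h4⟩ := IsRich.exists_branch x (Set.range fun i : {i // some i ∈ s} => y i)
      (fun t => ∃ i, y i = t ∧ C i) (Set.finite_range _)
      (by rintro _ ⟨i, rfl⟩; exact h1 i)
      (by
        rintro _ ⟨i, rfl⟩ _ ⟨j, rfl⟩ ⟨k, hk, hC⟩ hj
        rw [← hk]
        exact h2 k j hC fun hC' => hj ⟨j, rfl, hC'⟩)
    refine ⟨fun _ => d, ?_⟩
    rintro (_ | i) hs
    · simpa [realize_ltFormula, z] using h3
    · refine (hreal _ _ _).2 ?_
      obtain ⟨h5, h6⟩ := h4 _ ⟨⟨i, hs⟩, rfl⟩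
      refine ⟨h5, h6.trans ⟨?_, fun h => ⟨i, rfl, h⟩⟩⟩
      rintro ⟨k, hk, hC⟩
      by_contra hC'
      exact (h1 k).ne' (by rw [← h2 k i hC hC', hk]; simp))
  exact ⟨N, f, g PUnit.unit, by simpa [realize_ltFormula, z] using hg none,
    fun i => (hreal _ _ _).1 (hg (some i))⟩

end LTR

/-! ### Mutually indiscernible sequences in trees -/

namespace TRTree

variable {M : Type*} [TRTree M] {P Q δ : Type*}

theorem lt_inf_trans {d x y z : M} (h1 : d < x ⊓ y) (h2 : d < y ⊓ z) : d < x ⊓ z := by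
  rcases chain (x := y) (y := x ⊓ y) (z := y ⊓ z) inf_le_right inf_le_left with h | h
  · exact h1.trans_le (le_inf inf_le_left (h.trans inf_le_right))
  · exact h2.trans_le (le_inf (h.trans inf_le_left) inf_le_right)

/-- The sequence `a` of tuples is indiscernible over the tuple `w` for quantifier-free formulas. -/
def QfIndiscernible (a : ℕ → P → M) (w : δ → M) : Prop :=
  ∀ (n : ℕ) (i j : Fin n ↪o ℕ), SameType (Sum.elim (fun p : Fin n × P => a (i p.1) p.2) w)
    (Sum.elim (fun p : Fin n × P => a (j p.1) p.2) w)

/-- The tuples of the sequence are closed under meets, uniformly. -/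
def MeetClosed (a : ℕ → P → M) : Prop := ∀ k l, ∃ m, ∀ i, a i k ⊓ a i l = a i m

theorem meetClosed_pairs {τ : Type*} {t : ℕ → τ → M} (h : ∀ i, SameType (t 0) (t i)) :
    MeetClosed (fun i (p : τ × τ) => t i p.1 ⊓ t i p.2) := by
  intro k l
  obtain ⟨p, q, h1, -⟩ := (SameType.refl (t 0)).four k.1 k.2 l.1 l.2
  exact ⟨(p, q), fun i => ((h i).pairs.inf_eq k l (p, q)).1 h1⟩

namespace QfIndiscernible

variable {a : ℕ → P → M} {w : δ → M}

theorem comp {ε : Type*} (h : QfIndiscernible a w) (g : ε → δ) : QfIndiscernible a (w ∘ g) := by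
  intro n i j
  have := (h n i j).comp (Sum.map id g)
  simpa only [Sum.elim_comp_map, Function.comp_id] using this

theorem one (h : QfIndiscernible a w) (i j : ℕ) :
    SameType (Sum.elim (a i) w) (Sum.elim (a j) w) := by
  let e : ℕ → (Fin 1 ↪o ℕ) := fun i => OrderEmbedding.ofStrictMono (fun _ => i)
    (fun x y hxy => absurd hxy (by simp [Subsingleton.elim x y]))
  have := (h 1 (e i) (e j)).comp (Sum.map (fun p => (0, p)) id)
  simp only [Sum.elim_comp_map, Function.comp_id] at this
  exact this

theorem two (h : QfIndiscernible a w) {i i' j j' : ℕ} (hi : i < i') (hj : j < j') :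
    SameType (Sum.elim (Sum.elim (a i) (a i')) w) (Sum.elim (Sum.elim (a j) (a j')) w) := by
  let e : ∀ i i' : ℕ, i < i' → (Fin 2 ↪o ℕ) := fun i i' hi =>
    OrderEmbedding.ofStrictMono ![i, i'] (by
      intro x y hxy
      fin_cases x <;> fin_cases y <;> simp_all)
  have := (h 2 (e i i' hi) (e j j' hj)).comp
    (Sum.map (Sum.elim (fun p => (0, p)) (fun p => (1, p))) id)
  simp only [Sum.elim_comp_map, Function.comp_id, Sum.comp_elim] at this
  exact this

theorem sameType (h : QfIndiscernible a w) (i j : ℕ) : SameType (a i) (a j) :=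
  (h.one i j).comp Sum.inl

end QfIndiscernible

/-- Elements of mutually indiscernible sequences that share a cone of an element common to all the
tuples do so independently of their places in the sequences. -/
theorem lt_inf_zero {a : ℕ → P → M} {w : δ → M} (h : QfIndiscernible a w) {r k l : P} {d : M}
    (hr : ∀ i, a i r = d) {i j : ℕ} (hkl : d < a i k ⊓ a j l) : d < a 0 k ⊓ a 0 l := by
  have key : ∀ {i j : ℕ} {k l : P}, i < j → d < a i k ⊓ a j l → d < a 0 k ⊓ a 0 l := by
    intro i j k l hij hkl
    have h0 : ∀ i' j', i' < j' → d < a i' k ⊓ a j' l := fun i' j' h' => by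
      rw [← hr i'] at ⊢
      rw [← hr i] at hkl
      exact ((h.two hij h').lt_inf (Sum.inl (Sum.inl k)) (Sum.inl (Sum.inr l))
        (Sum.inl (Sum.inl r))).1 hkl
    have h1 : d < a 0 k ⊓ a 1 k :=
      lt_inf_trans (h0 0 2 (by norm_num)) (by rw [inf_comm]; exact h0 1 2 (by norm_num))
    have h2 : d < a 1 k ⊓ a 1 l := lt_inf_trans (by rwa [inf_comm]) (h0 0 1 (by norm_num))
    rw [← hr 0]
    rw [← hr 1] at h2
    exact ((h.sameType 1 0).lt_inf k l r).1 h2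
  rcases lt_trichotomy i j with hij | rfl | hij
  · exact key hij hkl
  · rw [← hr i] at hkl
    rw [← hr 0]
    exact ((h.sameType i 0).lt_inf k l r).1 hkl
  · rw [inf_comm] at hkl ⊢
    exact key hij hkl

section Cross

variable {a : ℕ → P → M} {b : ℕ → Q → M}

theorem sameType_two_two (ha : QfIndiscernible a (Function.uncurry b))
    (hb : QfIndiscernible b (Function.uncurry a)) {i i' j j' : ℕ} (hi : i < i') (hj : j < j') :
    SameType (Sum.elim (Sum.elim (a i) (a i')) (Sum.elim (b j) (b j')))
      (Sum.elim (Sum.elim (a 0) (a 1)) (Sum.elim (b 0) (b 1))) := by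
  have h1 := (ha.two hi zero_lt_one).comp
    (Sum.map id (Sum.elim (fun q => (j, q)) (fun q => (j', q))))
  have h2 := (hb.two hj zero_lt_one).comp
    (Sum.elim (fun p => Sum.inr (Sum.elim (fun p => (0, p)) (fun p => (1, p)) p)) Sum.inl)
  refine SameType.trans (v' := Sum.elim (Sum.elim (a 0) (a 1)) (Sum.elim (b j) (b j'))) ?_ ?_
  · convert h1 using 1 <;>
    · funext x
      rcases x with (x | x) | (x | x) <;> rfl
  · convert h2 using 1 <;>
    · funext x
      rcases x with (x | x) | (x | x) <;> rfl

/-- If the intervals `(b i l', b i m')` have no common element although `a i m` bounds all their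
lower ends, then on the branch of `a 0 m` they are disjoint, and form a decreasing or an increasing
sequence. -/
theorem exists_inf_le_of_not_lt (hb : QfIndiscernible b (Function.uncurry a))
    (ha : QfIndiscernible a (Function.uncurry b)) {m : P} {l' m' : Q}
    (h : ∀ i j, b j l' < a i m ⊓ b j m') {i j k : ℕ} (hn : ¬ b i l' < b j m' ⊓ b k m') :
    a 0 m ⊓ b 1 m' ≤ b 0 l' ∨ a 0 m ⊓ b 0 m' ≤ b 1 l' := by
  have key : ∀ j, ¬ b i l' < a 0 m ⊓ b j m' →
      a 0 m ⊓ b 1 m' ≤ b 0 l' ∨ a 0 m ⊓ b 0 m' ≤ b 1 l' := by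
    intro j hj
    have h1 : a 0 m ⊓ b j m' ≤ b i l' := by
      rcases chain (x := a 0 m) (y := a 0 m ⊓ b j m') (z := b i l') inf_le_left
        ((h 0 i).le.trans inf_le_left) with h2 | h2
      · exact h2
      · by_contra h3
        exact hj (lt_of_le_not_ge h2 h3)
    rcases lt_trichotomy i j with hij | rfl | hij
    · exact Or.inl (((sameType_two_two ha hb zero_lt_one hij).le_iff (Sum.inl (Sum.inl m))
        (Sum.inr (Sum.inr m')) (Sum.inr (Sum.inl l'))).1 h1)
    · exact absurd (h 0 i) hj
    · exact Or.inr (((sameType_two_two ha hb zero_lt_one hij).le_iff (Sum.inl (Sum.inl m))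
        (Sum.inr (Sum.inl m')) (Sum.inr (Sum.inr l'))).1 h1)
  by_cases hj : b i l' < a 0 m ⊓ b j m'
  · by_cases hk : b i l' < a 0 m ⊓ b k m'
    · exact absurd (lt_inf_trans (by rwa [inf_comm]) hk) hn
    · exact key k hk
  · exact key j hj

/-- Two mutually indiscernible sequences of intervals `(a i l, a i m)` and `(b i l', b i m')` are
given such that the meet of the upper ends of the two first members lies above both lower ends.
Then in one of the sequences all lower ends are below all meets of the upper ends. -/
theorem forall_lt_or_forall_lt (ha : QfIndiscernible a (Function.uncurry b))
    (hb : QfIndiscernible b (Function.uncurry a)) {l m : P} {l' m' : Q}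
    (h1 : a 0 l < a 0 m ⊓ b 0 m') (h2 : b 0 l' < a 0 m ⊓ b 0 m') :
    (∀ i j k, a i l < a j m ⊓ a k m) ∨ ∀ i j k, b i l' < b j m' ⊓ b k m' := by
  have F1 : ∀ i j, a i l < a i m ⊓ b j m' := fun i j =>
    ((sameType_two_two ha hb i.lt_succ_self j.lt_succ_self).lt_inf (Sum.inl (Sum.inl m))
      (Sum.inr (Sum.inl m')) (Sum.inl (Sum.inl l))).2 h1
  have F2 : ∀ i j, b j l' < a i m ⊓ b j m' := fun i j =>
    ((sameType_two_two ha hb i.lt_succ_self j.lt_succ_self).lt_inf (Sum.inl (Sum.inl m))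
      (Sum.inr (Sum.inl m')) (Sum.inr (Sum.inl l'))).2 h2
  by_contra hne
  push Not at hne
  obtain ⟨⟨i, j, k, hA⟩, ⟨i', j', k', hB⟩⟩ := hne
  have hA := exists_inf_le_of_not_lt ha hb (fun i j => by rw [inf_comm]; exact F1 j i) hA
  have hB := exists_inf_le_of_not_lt hb ha F2 hB
  rw [inf_comm, inf_comm (b 0 m')] at hA
  -- each of the two sequences of intervals is decreasing or increasing; the relations between the
  -- meets of the upper ends contradict each other in all four cases
  rcases hA with hA | hA <;> rcases hB with hB | hB
  · exact lt_irrefl _ ((F2 1 0).trans_le (hA.trans ((F1 0 1).le.trans hB)))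
  · have h3 : a 0 m ⊓ b 0 m' ≤ a 1 m ⊓ b 0 m' :=
      le_inf (hB.trans ((F2 1 1).le.trans inf_le_left)) inf_le_right
    exact lt_irrefl _ (((F1 0 0).trans_le h3).trans_le hA)
  · have h3 : a 0 m ⊓ b 0 m' ≤ a 0 m ⊓ b 1 m' :=
      le_inf inf_le_left (hA.trans ((F1 1 1).le.trans inf_le_right))
    exact lt_irrefl _ (((F2 0 0).trans_le h3).trans_le hB)
  · rcases chain (x := a 1 m ⊓ b 1 m') (F1 1 1).le (F2 1 1).le with h3 | h3
    · have h4 : a 0 m ⊓ b 0 m' = a 1 l := le_antisymm hA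
        (le_inf (h3.trans ((F2 0 1).le.trans inf_le_left)) ((F1 1 0).le.trans inf_le_right))
      have h5 : a 0 m ⊓ b 1 m' = a 1 l :=
        ((sameType_two_two ha hb zero_lt_one one_lt_two).inf_eq (Sum.inl (Sum.inl m))
          (Sum.inr (Sum.inl m')) (Sum.inl (Sum.inr l))).2 h4
      exact lt_irrefl _ ((h5 ▸ F2 0 1).trans_le h3)
    · have h4 : a 0 m ⊓ b 0 m' = b 1 l' := le_antisymm hB
        (le_inf ((F2 0 1).le.trans inf_le_left) (h3.trans ((F1 1 0).le.trans inf_le_right)))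
      have h5 : a 1 m ⊓ b 0 m' = b 1 l' :=
        ((sameType_two_two ha hb one_lt_two zero_lt_one).inf_eq (Sum.inl (Sum.inl m))
          (Sum.inr (Sum.inl m')) (Sum.inr (Sum.inr l'))).2 h4
      exact lt_irrefl _ ((h5 ▸ F1 1 0).trans_le h3)

end Cross

end TRTree

/-! ### One of two mutually indiscernible sequences can be moved -/

namespace LTR

open TRTree Structure

variable {M : Theory.ModelType.{0, 0, w} DTR} {P Q : Type*}

/-- In an elementary extension some `c'` has the type of `c` over the first tuple of the sequence
`b`, and `b` is indiscernible over `c'`. -/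
def IsMovable (b : ℕ → Q → M) (c : M) : Prop :=
  ∃ (N : Theory.ModelType.{0, 0, w} DTR) (f : M ↪ₑ[LTR] N) (c' : N),
    SameType (adjoin (b 0) c) (adjoin (f ∘ b 0) c') ∧
    ∀ (n : ℕ) (i j : Fin n ↪o ℕ), SameType (adjoin (fun p : Fin n × Q => f (b (i p.1) p.2)) c')
      (adjoin (fun p : Fin n × Q => f (b (j p.1) p.2)) c')

variable {a : ℕ → P → M} {b : ℕ → Q → M} {c : M}

theorem isMovable_of_qfIndiscernible {s : M} (h : QfIndiscernible b (fun _ : Unit => s))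
    (hs : SameType (adjoin (b 0) c) (adjoin (b 0) s)) : IsMovable b c := by
  refine ⟨M, ElementaryEmbedding.refl LTR M, s, hs, fun n i j => ?_⟩
  have := (h n i j).comp (fun o : Option (Fin n × Q) => o.elim (Sum.inr ()) Sum.inl)
  convert this using 1 <;>
  · funext o
    cases o <;> rfl

/-- The entry `a i p` of the other sequence serves as `c'` if it is closer to `c` than the tuple
`b 0` is. -/
theorem isMovable_of_inf_lt (hb : QfIndiscernible b (Function.uncurry a)) {i : ℕ} {p : P}
    (h : ∀ k, b 0 k ⊓ c < c ⊓ a i p) : IsMovable b c :=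
  isMovable_of_qfIndiscernible (s := a i p) (hb.comp fun _ => (i, p)) (SameType.adjoin_of_inf_lt h)

theorem isMovable_of_eq (hb : QfIndiscernible b (Function.uncurry a)) {i : ℕ} {p : P}
    (h : a i p = c) : IsMovable b c :=
  isMovable_of_qfIndiscernible (s := c) (h ▸ hb.comp fun _ => (i, p)) (SameType.refl _)

theorem sameType_seq {δ : Type*} {w : δ → M} (hb : QfIndiscernible b w)
    {N : Theory.ModelType.{0, 0, w} DTR} (f : M ↪ₑ[LTR] N) {n : ℕ} (i j : Fin n ↪o ℕ) :
    SameType (fun p : Fin n × Q => f (b (i p.1) p.2)) (fun p : Fin n × Q => f (b (j p.1) p.2)) :=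
  ((sameType_map f (fun p : Fin n × Q => b (i p.1) p.2)).symm.trans ((hb n i j).comp Sum.inl)).trans
    (sameType_map f _)

theorem map_lt_iff {N : Theory.ModelType.{0, 0, w} DTR} (f : M ↪ₑ[LTR] N) (x y : M) :
    f x < f y ↔ x < y := by
  rw [lt_iff_le_not_ge, lt_iff_le_not_ge, map_le_iff, map_le_iff]

/-- The element `c` is the limit of a chain in the first tuple, and the corresponding chains
in the other tuples lie on one branch. -/
theorem isMovable_of_limit {δ : Type*} {w : δ → M} (hb : QfIndiscernible b w)
    (h1 : ∀ k, ∃ m, b 0 m ≤ c ∧ ¬ b 0 m ≤ b 0 k)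
    (h2 : ∀ i j k l, b 0 k ≤ c → b 0 l ≤ c → b i k ≤ b j l ∨ b j l ≤ b i k) : IsMovable b c := by
  obtain ⟨N, f, d, hd, -⟩ := exists_cut_extension (M := M)
    (fun p : ℕ × {k // b 0 k ≤ c} => b p.1 p.2) (fun e : Empty => e.elim)
    (fun p q => h2 p.1 q.1 p.2 q.2 p.2.2 q.2.2) (fun _ e => e.elim)
  refine ⟨N, f, d, (sameType_map f (b 0)).adjoin_of_limit fun k => ?_, fun n i j =>
    (sameType_seq hb f i j).adjoin_of_limit fun k => ?_⟩
  · obtain ⟨m, hm, hm'⟩ := h1 k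
    exact ⟨m, hm, (hd (0, ⟨m, hm⟩)).le, hm'⟩
  · obtain ⟨m, hm, hm'⟩ := h1 k.2
    refine ⟨(k.1, m), (hd (i k.1, ⟨m, hm⟩)).le, (hd (j k.1, ⟨m, hm⟩)).le, ?_⟩
    rw [map_le_iff, ← (hb.sameType 0 (i k.1)).le]
    exact hm'

/-- The element `c` opens a new cone above an element that all the tuples have in common. -/
theorem isMovable_of_branch {δ : Type*} {w : δ → M} (hb : QfIndiscernible b w) {r : Q} {d : M}
    (hr : ∀ i, b i r = d) (hdc : d < c) (h : ∀ k, b 0 k ⊓ c ≤ d) : IsMovable b c := by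
  obtain ⟨N, f, z, hz, hz'⟩ := exists_branch_extension (M := M) d
    (fun p : {p : ℕ × Q // d < b p.1 p.2} => b p.1.1 p.1.2) (fun p => Adj c (b 0 p.1.2))
    (fun p => p.2) (by
      rintro ⟨⟨i, k⟩, hk⟩ ⟨⟨j, l⟩, hl⟩ hC hC'
      by_contra hne
      have h1 : d < b 0 k ⊓ b 0 l := lt_inf_zero hb hr
        (lt_of_le_of_ne (le_inf hk.le hl.le) (Ne.symm hne))
      have h2 : c ⊓ b 0 k < b 0 k ⊓ b 0 l := lt_of_le_of_lt (by rw [inf_comm]; exact h k) h1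
      exact hC' (adj_symm ((adj_iff_of_inf_lt h2).1 (adj_symm hC))))
  have hinf : ∀ i k, f (b i k) ⊓ z ≤ f d := fun i k => by
    by_cases hk : d < b i k
    · rw [inf_comm, (hz' ⟨(i, k), hk⟩).1]
    · by_contra hn
      exact hk ((map_lt_iff f _ _).1 ((lt_of_not_le inf_le_right hz.le hn).trans_le inf_le_left))
  have hlt : ∀ i k, d < b i k ↔ d < b 0 k := fun i k => by
    rw [← hr i, (hb.sameType i 0).lt, hr i, hr 0]
  have hadj : ∀ i k, d < b i k → (Adj z (f (b i k)) ↔ Adj c (b 0 k)) := fun i k hk =>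
    (hz' ⟨(i, k), hk⟩).2
  refine ⟨N, f, z, (sameType_map f (b 0)).adjoin_of_branch (r := r) ?_ ?_ ?_ ?_ ?_,
    fun n i j => ?_⟩
  · rwa [hr]
  · simpa [hr] using hz
  · simpa [hr] using h
  · simpa [hr] using hinf 0
  · intro k hk
    rw [hr] at hk
    exact (hadj 0 k hk).symm
  · rcases n with - | n
    · exact SameType.adjoin_of_isEmpty _ _ _ _
    · refine (sameType_seq hb f i j).adjoin_of_branch (r := (0, r)) ?_ ?_ ?_ ?_ ?_
      · simpa [hr] using hz
      · simpa [hr] using hz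
      · simpa [hr] using fun k l => hinf (i k) l
      · simpa [hr] using fun k l => hinf (j k) l
      · rintro ⟨k, l⟩ hk
        simp only [hr, map_lt_iff] at hk
        have hk' := (hlt (j k) l).2 ((hlt (i k) l).1 hk)
        exact (hadj _ _ hk).trans (hadj _ _ hk').symm

/-- The branch of `c` leaves the first tuple in a cut, and the corresponding cuts of the other
tuples can be filled at the same time. -/
theorem isMovable_of_cut {δ : Type*} {w : δ → M} (hb : QfIndiscernible b w) (hc : MeetClosed b)
    {u : Q} {d : M} (hd : b 0 u ⊓ c = d) (hne : ∀ k, b 0 k ≠ d)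
    (h : ∀ l k, b 0 l < d → d < b 0 k → ∀ i j j', b i l < b j k ⊓ b j' k) : IsMovable b c := by
  have hdu : d < b 0 u := lt_of_le_of_ne (hd ▸ inf_le_left) (hne u).symm
  have hdc : d ≤ c := hd ▸ inf_le_right
  -- the upper part of the cut is directed downwards, also across different tuples
  have hdir : ∀ l k k', b 0 l < d → d < b 0 k → d < b 0 k' → ∀ i j j',
      b i l < b j k ⊓ b j' k' := by
    intro l k k' hl hk hk' i j j'
    obtain ⟨m, hm⟩ := hc k k'
    have h1 : d < b 0 m := lt_of_le_of_ne (hm 0 ▸ le_inf hk.le hk'.le) (hne m).symm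
    refine (h l m hl h1 i j j').trans_le ?_
    rw [← hm, ← hm]
    exact inf_le_inf inf_le_left inf_le_right
  obtain ⟨N, f, d', hL, hU⟩ := exists_cut_extension (M := M)
    (fun p : ℕ × {k // b 0 k < d} => b p.1 p.2)
    (fun p : (ℕ × {k // d < b 0 k}) × (ℕ × {k // d < b 0 k}) => b p.1.1 p.1.2 ⊓ b p.2.1 p.2.2)
    (by
      have h1 : ∀ (i : ℕ) (k : {k // b 0 k < d}), b i k ≤ b 0 u := fun i k =>
        (h k u k.2 hdu i 0 0).le.trans inf_le_left
      exact fun p q => chain (h1 _ _) (h1 _ _))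
    (by
      rintro ⟨i, l, hl⟩ ⟨⟨j₁, k₁, h₁⟩, ⟨j₂, k₂, h₂⟩⟩ ⟨⟨j₃, k₃, h₃⟩, ⟨j₄, k₄, h₄⟩⟩
      have e1 : b i l < b j₁ k₁ ⊓ b j₂ k₂ ⊓ b j₁ k₁ := by
        rw [inf_eq_left.2 inf_le_left]
        exact hdir _ _ _ hl h₁ h₂ _ _ _
      have e2 : b i l < b j₃ k₃ ⊓ (b j₃ k₃ ⊓ b j₄ k₄) := by
        rw [inf_eq_right.2 inf_le_left]
        exact hdir _ _ _ hl h₃ h₄ _ _ _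
      exact lt_inf_trans (lt_inf_trans e1 (hdir _ _ _ hl h₁ h₃ _ _ _)) e2)
  replace hL : ∀ i k, b 0 k < d → f (b i k) < d' := fun i k hk => hL (i, ⟨k, hk⟩)
  replace hU : ∀ i j k l, d < b 0 k → d < b 0 l → d' < f (b i k) ⊓ f (b j l) :=
    fun i j k l hk hl => by
      rw [← map_inf]
      exact hU ((i, ⟨k, hk⟩), (j, ⟨l, hl⟩))
  have hU' : ∀ i k, d < b 0 k → d' < f (b i k) := fun i k hk =>
    (hU i i k k hk hk).trans_le inf_le_left
  have hcut : ∀ k, d < b 0 k ∨ ∃ m, b 0 m < d ∧ ∀ i, b i k ⊓ b i u = b i m := fun k => by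
    obtain ⟨m, hm⟩ := hc k u
    rcases chain hdu.le (hm 0 ▸ inf_le_right) with h1 | h1
    · exact Or.inl ((lt_of_le_of_ne h1 (hne m).symm).trans_le (hm 0 ▸ inf_le_left))
    · exact Or.inr ⟨m, lt_of_le_of_ne h1 (hne m), hm⟩
  have hfar : ∀ i k m, b 0 m < d → (∀ i, b i k ⊓ b i u = b i m) →
      f (b i k) ⊓ f (b i u) < f (b i u) ⊓ d' := fun i k m hm hk => by
    rw [← map_inf, hk, inf_eq_right.2 (hU' i u hdu).le]
    exact hL i m hm
  have hU'' : ∀ i k, d' ≤ f (b i k) → d < b 0 k := fun i k hk => by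
    rcases hcut k with h1 | ⟨m, hm, hm'⟩
    · exact h1
    · exact absurd (le_inf (inf_le_right.trans hk) inf_le_left) (hfar i k m hm hm').not_ge
  have K1 : SameType (adjoin (b 0) d) (adjoin (f ∘ b 0) d') :=
    (sameType_map f (b 0)).adjoin_of_cut (fun k l => (hc k l).imp fun m hm => hm 0) hdu.le hne
      (hL 0) (hU' 0)
  have K2 : ∀ (n : ℕ) (i j : Fin n ↪o ℕ),
      SameType (adjoin (fun p : Fin n × Q => f (b (i p.1) p.2)) d')
        (adjoin (fun p : Fin n × Q => f (b (j p.1) p.2)) d') := by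
    intro n i j
    have h0 := sameType_seq hb f i j
    refine h0.adjoin_of_forall ?_ ?_
    · rintro ⟨r, k⟩
      rcases hcut k with h1 | ⟨m, hm, hm'⟩
      · exact Or.inl ⟨(hU' _ _ h1).le, (hU' _ _ h1).le⟩
      · exact Or.inr ⟨(r, u), h0.closer (k := (r, k)) (m := (r, u)) (hfar _ _ m hm hm')
          (hfar _ _ m hm hm')⟩
    · rintro ⟨r, k⟩ ⟨s, l⟩ hk hl
      have hk := hU'' _ _ hk
      have hl := hU'' _ _ hl
      exact iff_of_false (hU _ _ _ _ hk hl).not_ge (hU _ _ _ _ hk hl).not_ge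
  by_cases hcd : c = d
  · exact ⟨N, f, d', hcd ▸ K1, K2⟩
  have hdc' : d < c := lt_of_le_of_ne hdc (Ne.symm hcd)
  have hout : ∀ k, b 0 k ⊓ c ≤ d := fun k => by
    rcases hcut k with h1 | ⟨m, hm, hm'⟩
    · by_contra hn
      have h2 := lt_of_not_le inf_le_right hdc hn
      obtain ⟨m, hm⟩ := hc u k
      refine hne m ?_
      rw [← hm 0, ← hd]
      exact inf_eq_of_inf_lt (by rw [hd, inf_comm c]; exact h2)
    · have h2 : b 0 k ⊓ b 0 u < b 0 u ⊓ c := by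
        rw [hm', hd]
        exact hm
      rw [inf_eq_of_inf_lt h2, hm']
      exact hm.le
  -- a new cone above `d'`, adjacent to the cone of the tuples if and only if `c` is
  obtain ⟨z, hz, hz'⟩ := IsRich.exists_branch d' {f (b 0 u)} (fun _ => Adj c (b 0 u))
    (Set.finite_singleton _) (by simpa using hU' 0 u hdu)
    (fun _ _ _ _ h1 h2 => absurd h1 h2)
  obtain ⟨hz1, hz2⟩ := hz' _ rfl
  have hnear : ∀ i k, d < b 0 k → z ⊓ f (b 0 u) < f (b 0 u) ⊓ f (b i k) := fun i k hk => by
    rw [hz1]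
    exact hU _ _ _ _ hdu hk
  have hzout : ∀ i k, f (b i k) ⊓ z ≤ d' := fun i k => by
    by_contra hn
    have h2 := lt_of_not_le inf_le_right hz.le hn
    have h3 := hU'' i k (h2.le.trans inf_le_left)
    rw [inf_comm, inf_eq_of_inf_lt (hnear i k h3), hz1] at h2
    exact h2.false
  have hzadj : ∀ i k, d < b 0 k → (Adj z (f (b i k)) ↔ Adj c (b 0 u)) := fun i k hk => by
    rw [adj_comm, ← adj_iff_of_inf_lt (hnear i k hk), adj_comm, hz2]
  refine ⟨N, f, z, ?_, fun n i j => ?_⟩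
  · have := K1.adjoin_of_branch (r := none) (c := c) (c' := z) hdc' hz (by
      rintro (_ | k)
      · exact inf_le_left
      · exact hout k) (by
      rintro (_ | k)
      · exact inf_le_left
      · exact hzout 0 k) (by
      rintro (_ | k) hk
      · exact absurd hk (lt_irrefl _)
      · refine Iff.trans ?_ (hzadj 0 k hk).symm
        have h1 : c ⊓ b 0 u < b 0 u ⊓ b 0 k := by
          obtain ⟨m, hm⟩ := hc u k
          rw [inf_comm c, hd, hm 0]
          exact lt_of_le_of_ne (hm 0 ▸ le_inf hdu.le (le_of_lt hk)) (hne m).symm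
        rw [adj_comm, adjoin_some, ← adj_iff_of_inf_lt h1, adj_comm])
    exact this.comp_adjoin some
  · have := (K2 n i j).adjoin_of_branch (r := none) (c := z) (c' := z) hz hz (by
      rintro (_ | k)
      · exact inf_le_left
      · exact hzout _ _) (by
      rintro (_ | k)
      · exact inf_le_left
      · exact hzout _ _) (by
      rintro (_ | k) hk
      · exact absurd hk (lt_irrefl _)
      · have hk' := hU'' _ _ (le_of_lt hk)
        exact (hzadj _ _ hk').trans (hzadj _ _ hk').symm)
    exact this.comp_adjoin some

/-- The dichotomy behind inp-minimality: of two mutually indiscernible sequences of meet-closed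
tuples, one can be moved over `c`. -/
theorem isMovable_or_isMovable (ha : QfIndiscernible a (Function.uncurry b))
    (hb : QfIndiscernible b (Function.uncurry a)) (hca : MeetClosed a) (hcb : MeetClosed b)
    (c : M) : IsMovable a c ∨ IsMovable b c := by
  by_cases h1 : ∃ p, a 0 p = c
  · obtain ⟨p, hp⟩ := h1
    exact Or.inr (isMovable_of_eq hb hp)
  by_cases h2 : ∃ p, ∀ k, b 0 k ⊓ c < c ⊓ a 0 p
  · obtain ⟨p, hp⟩ := h2
    exact Or.inr (isMovable_of_inf_lt hb hp)
  by_cases h3 : ∃ k, ∀ p, a 0 p ⊓ c < c ⊓ b 0 k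
  · obtain ⟨k, hk⟩ := h3
    exact Or.inl (isMovable_of_inf_lt ha hk)
  push Not at h1 h2 h3
  -- the traces of the two tuples on the branch of `c` are mutually cofinal
  replace h2 : ∀ p, ∃ k, a 0 p ⊓ c ≤ b 0 k ⊓ c := fun p => by
    obtain ⟨k, hk⟩ := h2 p
    rw [inf_comm c] at hk
    exact ⟨k, (chain inf_le_right inf_le_right).elim id fun h => (h.eq_of_not_lt hk).ge⟩
  replace h3 : ∀ k, ∃ p, b 0 k ⊓ c ≤ a 0 p ⊓ c := fun k => by
    obtain ⟨p, hp⟩ := h3 k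
    rw [inf_comm c] at hp
    exact ⟨p, (chain inf_le_right inf_le_right).elim id fun h => (h.eq_of_not_lt hp).ge⟩
  by_cases h4 : ∃ u, ∀ p, a 0 p ⊓ c ≤ a 0 u ⊓ c
  · obtain ⟨u, hu⟩ := h4
    obtain ⟨v, hv⟩ := h2 u
    obtain ⟨d, hd⟩ : ∃ d, a 0 u ⊓ c = d := ⟨_, rfl⟩
    have hv' : ∀ k, b 0 k ⊓ c ≤ d := fun k => by
      obtain ⟨p, hp⟩ := h3 k
      exact hd ▸ hp.trans (hu p)
    have hvd : b 0 v ⊓ c = d := le_antisymm (hv' v) (hd ▸ hv)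
    by_cases hA : ∃ p, a 0 p = d <;> by_cases hB : ∃ k, b 0 k = d
    · obtain ⟨p, hp⟩ := hA
      obtain ⟨k, hk⟩ := hB
      refine Or.inl (isMovable_of_branch ha (r := p) (fun i => ?_)
        (lt_of_le_of_ne (hd ▸ inf_le_right) fun h => h1 p (hp.trans h)) fun p => hd ▸ hu p)
      exact (((ha.one 0 i).eq (Sum.inl p) (Sum.inr (0, k))).1 (hp.trans hk.symm)).trans hk
    · obtain ⟨p, hp⟩ := hA
      push Not at hB
      refine Or.inr (isMovable_of_cut hb hcb hvd hB fun l k hl hk i j j' => ?_)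
      have e1 : b i l < d := by
        rw [← hp] at hl ⊢
        exact ((hb.one 0 i).lt (Sum.inl l) (Sum.inr (0, p))).1 hl
      have e2 : ∀ j, d < b j k := fun j => by
        rw [← hp] at hk ⊢
        exact ((hb.one 0 j).lt (Sum.inr (0, p)) (Sum.inl k)).1 hk
      exact e1.trans_le (le_inf (e2 j).le (e2 j').le)
    · obtain ⟨k, hk⟩ := hB
      push Not at hA
      refine Or.inl (isMovable_of_cut ha hca hd hA fun l p hl hp i j j' => ?_)
      have e1 : a i l < d := by
        rw [← hk] at hl ⊢
        exact ((ha.one 0 i).lt (Sum.inl l) (Sum.inr (0, k))).1 hl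
      have e2 : ∀ j, d < a j p := fun j => by
        rw [← hk] at hp ⊢
        exact ((ha.one 0 j).lt (Sum.inr (0, k)) (Sum.inl p)).1 hp
      exact e1.trans_le (le_inf (e2 j).le (e2 j').le)
    · -- `d` is new for both sequences and fills a cut in both
      push Not at hA hB
      by_contra hn
      push Not at hn
      have nA := mt (isMovable_of_cut ha hca hd hA) hn.1
      have nB := mt (isMovable_of_cut hb hcb hvd hB) hn.2
      push Not at nA nB
      obtain ⟨l, m, hl, hm, i, j, k, hijk⟩ := nA
      obtain ⟨l', m', hl', hm', i', j', k', hijk'⟩ := nB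
      have hmm : d ≤ a 0 m ⊓ b 0 m' := le_inf hm.le hm'.le
      rcases forall_lt_or_forall_lt ha hb (hl.trans_le hmm) (hl'.trans_le hmm) with h | h
      exacts [hijk (h i j k), hijk' (h i' j' k')]
  · -- no maximum: `c` is a limit of entries of `a 0`, and an entry of `b 0` above two of them
    -- is above the corresponding entries of all `a i`
    push Not at h4
    have hlt : ∀ p, ∃ q, a 0 p ⊓ c < a 0 q ⊓ c := fun p => by
      obtain ⟨q, hq⟩ := h4 p
      exact ⟨q, lt_of_not_le inf_le_right inf_le_right hq⟩
    refine Or.inl (isMovable_of_limit ha (fun p => ?_) (fun i j p q hp hq => ?_))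
    · obtain ⟨q, hq⟩ := hlt p
      obtain ⟨r, hr⟩ := hlt q
      obtain ⟨m, hm⟩ := hca q r
      have e : a 0 m = a 0 q ⊓ c := by
        rw [← hm 0]
        exact inf_eq_of_inf_lt (by rwa [inf_comm c])
      refine ⟨m, e ▸ inf_le_right, fun h => hq.not_ge ?_⟩
      exact le_inf (e ▸ h) inf_le_right
    · have key : ∀ p q, a 0 p ≤ a 0 q → a 0 q ≤ c → ∀ i j, a i p ≤ a j q ∨ a j q ≤ a i p := by
        intro p q hpq hq i j
        obtain ⟨k, hk⟩ := h2 q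
        have e : a 0 q ≤ b 0 k := (le_inf le_rfl hq).trans (hk.trans inf_le_left)
        have e' : ∀ r, a 0 r ≤ b 0 k → ∀ i, a i r ≤ b 0 k := fun r hr i =>
          ((ha.one 0 i).le (Sum.inl r) (Sum.inr (0, k))).1 hr
        exact chain (e' p (hpq.trans e) i) (e' q e j)
      rcases chain hp hq with h | h
      · exact key p q h hq i j
      · exact (key q p h hp j i).symm

end LTR

/-! ### Inp-minimality -/

namespace LTR

open TRTree Structure

section Tuples

variable {M : Type w} [LTR.Structure M] [TRTree M] [IsTRModel M]

theorem equivOver_of_sameType [IsRich M] {A : Set M} {γ : Type w} {x y : γ → M}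
    (h : SameType (Sum.elim (fun z : A => (z : M)) x) (Sum.elim (fun z : A => (z : M)) y)) :
    EquivOver LTR A x y :=
  fun φ => realize_iff_of_sameType h φ

/-- The tuple `a i` together with the parameters `A`. -/
def withParams (A : Set M) {σ : Type w} (a : ℕ → σ → M) (i : ℕ) : A ⊕ σ → M :=
  Sum.elim (fun z => (z : M)) (a i)

/-- The meet-closed tuple generated by the tuple `a i` and the parameters `A`. -/
def meetsWithParams (A : Set M) {σ : Type w} (a : ℕ → σ → M) (i : ℕ) (p : (A ⊕ σ) × (A ⊕ σ)) : M :=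
  withParams A a i p.1 ⊓ withParams A a i p.2

theorem qfIndiscernible_meetsWithParams {A : Set M} {ι : Type w} {σ : ι → Type w}
    {a : ∀ α, ℕ → σ α → M} (h : MutuallyIndiscernible LTR A a) {α β : ι} (hne : β ≠ α) :
    QfIndiscernible (meetsWithParams A (a α)) (Function.uncurry (meetsWithParams A (a β))) := by
  intro n i j
  let B : Set M := A ∪ {x | ∃ β, β ≠ α ∧ ∃ i k, a β i k = x}
  let g : Fin n → A ⊕ σ α → B ⊕ (Fin n × σ α) := fun r =>
    Sum.elim (fun z => Sum.inl ⟨z, Or.inl z.2⟩) (fun k => Sum.inr (r, k))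
  let g' : ℕ → A ⊕ σ β → B ⊕ (Fin n × σ α) := fun r =>
    Sum.elim (fun z => Sum.inl ⟨z, Or.inl z.2⟩)
      (fun k => Sum.inl ⟨a β r k, Or.inr ⟨β, hne, r, k, rfl⟩⟩)
  have h1 := (sameType_of_realize_iff (h α n i j)).pairs.comp
    (Sum.elim (fun p : Fin n × ((A ⊕ σ α) × (A ⊕ σ α)) => (g p.1 p.2.1, g p.1 p.2.2))
      (fun p : ℕ × ((A ⊕ σ β) × (A ⊕ σ β)) => (g' p.1 p.2.1, g' p.1 p.2.2)))
  convert h1 using 1 <;>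
  · funext x
    rcases x with ⟨r, x | x, y | y⟩ | ⟨r, x | x, y | y⟩ <;> rfl

end Tuples

/-- A sequence that can be moved over `b` is replaced by a sequence indiscernible over `b`. -/
theorem exists_indiscernible_of_isMovable {M : Theory.ModelType.{0, 0, w} DTR} {A : Set M}
    {σ : Type w} {a : ℕ → σ → M} {b : M} (h : IsMovable (meetsWithParams A a) b) :
    ∃ (N : Theory.ModelType.{0, 0, w} DTR) (f : M ↪ₑ[LTR] N) (a' : ℕ → σ → N),
      Indiscernible LTR (f '' (A ∪ {b})) a' ∧
      EquivOver LTR (f '' (A ∪ Set.range (a 0)))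
        (fun p : ℕ × σ => a' p.1 p.2) (fun p : ℕ × σ => f (a p.1 p.2)) := by
  obtain ⟨N, f, c, h1, h2⟩ := h
  have h1' : SameType (adjoin (withParams A a 0) b) (adjoin (f ∘ withParams A a 0) c) := by
    simpa [Function.comp_def, meetsWithParams] using h1.comp_adjoin (fun x => (x, x))
  let y' : Option (A ⊕ σ) → N := adjoin (f ∘ withParams A a 0) c
  obtain ⟨K, g, x, hx⟩ := exists_sameType_extension (fun p : ℕ × σ => f (a p.1 p.2))
    (f ∘ adjoin (withParams A a 0) b) y' ((sameType_map f _).symm.trans h1')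
  refine ⟨K, g.comp f, fun i k => x (i, k), fun n i j => ?_, ?_⟩
  · -- the parameters `A` are entries of every tuple of the sequence, but not of the empty family
    rcases n with - | n
    · rw [Subsingleton.elim (fun p : Fin 0 × σ => x (i p.1, p.2)) (fun p => x (j p.1, p.2))]
      exact fun _ => Iff.rfl
    have hk : ∀ z : (g.comp f) '' (A ∪ {b}), ∃ o : Option A,
        g (f (adjoin (withParams A a 0) b (o.map Sum.inl))) = z := by
      rintro ⟨_, z, hz | rfl, rfl⟩
      exacts [⟨some ⟨z, hz⟩, rfl⟩, ⟨none, rfl⟩]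
    choose k hk using hk
    let G : (Fin (n + 1) ↪o ℕ) → ((g.comp f) '' (A ∪ {b})) ⊕ (Fin (n + 1) × σ) → N := fun i =>
      Sum.elim (fun z => y' ((k z).map Sum.inl)) (fun p => f (a (i p.1) p.2))
    have hG : ∀ i : Fin (n + 1) ↪o ℕ, SameType
        (Sum.elim (fun z : (g.comp f) '' (A ∪ {b}) => (z : K)) (fun p => x (i p.1, p.2)))
        (G i) := fun i => by
      have := hx.comp (Sum.elim (fun z : (g.comp f) '' (A ∪ {b}) => Sum.inr ((k z).map Sum.inl))
        (fun p : Fin (n + 1) × σ => Sum.inl (i p.1, p.2)))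
      convert this using 1
      · funext z
        rcases z with z | z
        exacts [(hk z).symm, rfl]
      · funext z
        rcases z with z | z <;> rfl
    have hG' : SameType (G i) (G j) := by
      have := (h2 (n + 1) i j).comp (Sum.elim
        (fun z : (g.comp f) '' (A ∪ {b}) =>
          (k z).map fun z => ((0 : Fin (n + 1)), ((Sum.inl z : A ⊕ σ), (Sum.inl z : A ⊕ σ))))
        (fun p : Fin (n + 1) × σ => some (p.1, (Sum.inr p.2, Sum.inr p.2))))
      convert this using 1 <;>
      · funext z
        rcases z with z | z
        · cases hz : k z <;> simp [G, y', hz, meetsWithParams, withParams]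
        · simp [G, meetsWithParams, withParams]
    exact equivOver_of_sameType (((hG i).trans hG').trans (hG j).symm)
  · have hk : ∀ z : (g.comp f) '' (A ∪ Set.range (a 0)), ∃ o : A ⊕ σ,
        g (f (withParams A a 0 o)) = z := by
      rintro ⟨_, z, hz | ⟨k, rfl⟩, rfl⟩
      exacts [⟨Sum.inl ⟨z, hz⟩, rfl⟩, ⟨Sum.inr k, rfl⟩]
    choose k hk using hk
    refine equivOver_of_sameType ?_
    have h3 := hx.comp (Sum.elim
      (fun z : (g.comp f) '' (A ∪ Set.range (a 0)) => Sum.inr (some (k z))) Sum.inl)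
    have h4 := h3.trans (sameType_map g _)
    convert h4 using 1
    · funext z
      rcases z with z | z
      exacts [(hk z).symm, rfl]
    · funext z
      rcases z with z | z
      exacts [(hk z).symm, rfl]

theorem isInpMinimal_DTR : IsInpMinimal.{w} DTR := by
  intro M ι hι A σ a ha b
  obtain ⟨α, β, hne, -⟩ := Cardinal.mk_eq_two_iff.1 hι
  have hα := qfIndiscernible_meetsWithParams ha hne.symm
  have hβ := qfIndiscernible_meetsWithParams ha hne
  have hc : ∀ γ, MeetClosed (meetsWithParams A (a γ)) := fun γ => by
    refine meetClosed_pairs (t := withParams A (a γ)) fun i => ?_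
    have h1 : ∀ δ ≠ γ, SameType (withParams A (a γ) 0) (withParams A (a γ) i) := fun δ hδ => by
      have := ((qfIndiscernible_meetsWithParams ha hδ).sameType 0 i).comp (fun x => (x, x))
      simpa [Function.comp_def, meetsWithParams] using this
    by_cases h2 : γ = α
    · exact h1 β (h2 ▸ hne.symm)
    · exact h1 α (Ne.symm h2)
  rcases isMovable_or_isMovable hα hβ (hc α) (hc β) b with h | h
  exacts [⟨α, exists_indiscernible_of_isMovable h⟩, ⟨β, exists_indiscernible_of_isMovable h⟩]

end LTR

theorem mainTheorem5 :
    LTR.DTR.IsComplete ∧ IsInpMinimal.{w} LTR.DTR ∧ IsNTP2.{w} LTR.DTR :=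
  ⟨LTR.DTR_isComplete, LTR.isInpMinimal_DTR, 2, LTR.isInpMinimal_DTR⟩
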